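/- **Setting.** Let $\Gamma\subset\mathbb R^n\times\mathbb R^n\times\mathbb R$ be a domain (nonempty, open, connected) all of whose fibres $I(x,y)=\{z\in\mathbb R : (x,y,z)\in\Gamma\}$ are (possibly empty) open intervals, and let $g\in C^2(\Gamma)$ satisfy $g_z<0$ in $\Gamma$. Put $$\mathcal U=\{(x,g(x,y,z),g_x(x,y,z)) : (x,y,z)\in\Gamma\},\qquad \mathcal U(x,u)=\{p\in\mathbb R^n : (x,u,p)\in\mathcal U\},$$ $$E=g_{x,y}-(g_z)^{-1}g_{x,z}\otimes g_y,\qquad Q=-g_y/g_z .$$ For $(x,y,u)\in\Gamma^*:=\{(x,y,g(x,y,z)) : (x,y,z)\in\Gamma\}$ let $g^*(x,y,u)$ denote the unique $z$ with $(x,y,z)\in\Gamma$ and $g(x,y,z)=u$. Assume: * **A1**: for each $(x,u,p)\in\mathcal U$ there is a unique $(y,z)=(Y(x,u,p),Z(x,u,p))$ with $(x,y,z)\in\Gamma$, $g(x,y,z)=u$ and $g_x(x,y,z)=p$; * **A2**: $\det E\neq 0$ in $\Gamma$; * **A1\***: for all $(y,z)$ the mapping $x\mapsto Q(x,y,z)$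 is one-to-one on $\{x : (x,y,z)\in\Gamma\}$; * **A3w**: with $A(x,u,p)=g_{xx}(x,Y(x,u,p),Z(x,u,p))$, for all $x,\xi\in\mathbb R^n$ and $u\in\mathbb R$ the function $p\mapsto (A(x,u,p)\xi,\xi)$ is convex along every closed line segment contained in $\mathcal U(x,u)$ and orthogonal to $\xi$. A set $S\subset\mathbb R^n$ is called *$g$-convex with respect to $(y_0,z_0)\in\mathbb R^n\times\mathbb R$* if $S\times\{(y_0,z_0)\}\subset\Gamma$ and the image $Q(\cdot,y_0,z_0)(S)$ is convex. A function $u\in C^0(\Omega)$ on a domain $\Omega\subset\mathbb R^n$ is called *$g$-convex* if for each $x_0\in\Omega$ there is $(y,z)\in\mathbb R^n\times\mathbb R$ with $\Omega\times\{(y,z)\}\subset\Gamma$, $u(x_0)=g(x_0,y,z)$ and $u\ge g(\cdot,y,z)$ in $\Omega$. Its *$g$-normal mapping* $Tu$ assigns to $x_0\in\Omega$ the set of all $y\in\mathbb R^n$ such that $(x_0,y,u(x_0))\in\Gamma^*$ and, with $z=g^*(x_0,y,u(x_0))$, $\Omega\times\{(y,z)\}\subset\Gamma$ and $u\ge g(\cdot,y,z)$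 in $\Omega$; put $Tu(\Omega)=\bigcup_{x_0\in\Omega}Tu(x_0)$. **Theorem 3.1.** Let $u\in C^0(\Omega)$ be $g$-convex in a domain $\Omega\subset\mathbb R^n$, let $(y_0,z_0)\in\mathbb R^n\times\mathbb R$ be such that $\Omega\times\{(y_0,z_0)\}\subset\Gamma$, and put $g_0=g(\cdot,y_0,z_0)$. Assume that 1. $\Omega$ is $g$-convex with respect to $(y_0,z_0)$; 2. for all $y\in Tu(\Omega)$ and all $x\in\Omega$ one has $(x,y,g_0(x))\in\Gamma^*$, and the closed line segment joining $Dg_0(x)$ to $g_x(x,y,g^*(x,y,g_0(x)))$ is contained in $\mathcal U(x,g_0(x))$. Then the sections $$S(u,g_0)=\{x\in\Omega : u(x)<g_0(x)\},\qquad \tilde S(u,g_0)=\{x\in\Omega : u(x)\le g_0(x)\}$$ are $g$-convex with respect to $(y_0,z_0)$. -/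

import Mathlib

noncomputable section

namespace GenConvex

/-- Euclidean space `ℝⁿ`. -/
abbrev Vec (n : ℕ) := EuclideanSpace ℝ (Fin n)

variable {n : ℕ}

/-- `g_x(x, y, z)`, the gradient of `g` in the first variable. -/
def gx (g : Vec n × Vec n × ℝ → ℝ) (x y : Vec n) (z : ℝ) : Vec n :=
  gradient (fun x' => g (x', y, z)) x

/-- `g_y(x, y, z)`, the gradient of `g` in the second variable. -/
def gy (g : Vec n × Vec n × ℝ → ℝ) (x y : Vec n) (z : ℝ) : Vec n :=
  gradient (fun y' => g (x, y', z)) y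

/-- `g_z(x, y, z)`, the partial derivative of `g` in the last variable. -/
def gz (g : Vec n × Vec n × ℝ → ℝ) (x y : Vec n) (z : ℝ) : ℝ :=
  deriv (fun z' => g (x, y, z')) z

/-- The quadratic form `(g_xx(x, y, z) ξ, ξ)` of the Hessian of `g` in the first variable. -/
def gxxForm (g : Vec n × Vec n × ℝ → ℝ) (x y : Vec n) (z : ℝ) (ξ : Vec n) : ℝ :=
  fderiv ℝ (fderiv ℝ (fun x' => g (x', y, z))) x ξ ξ

/-- The matrix `E = g_{x,y} - (g_z)⁻¹ g_{x,z} ⊗ g_y`. -/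
def matE (g : Vec n × Vec n × ℝ → ℝ) (x y : Vec n) (z : ℝ) : Matrix (Fin n) (Fin n) ℝ :=
  Matrix.of fun i j =>
    fderiv ℝ (fun y' => gx g x y' z i) y (EuclideanSpace.single j 1)
      - (gz g x y z)⁻¹ * deriv (fun z' => gx g x y z' i) z * gy g x y z j

/-- The mapping `Q = - g_y / g_z`. -/
def mapQ (g : Vec n × Vec n × ℝ → ℝ) (x y : Vec n) (z : ℝ) : Vec n :=
  -((gz g x y z)⁻¹ • gy g x y z)

/-- `g` is a (normalised, `C²`) generating function on `Γ ⊆ ℝⁿ × ℝⁿ × ℝ`: `Γ` is a domain whose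
fibres `I(x, y) = {z | (x, y, z) ∈ Γ}` are (possibly empty) intervals, open because `Γ` is,
`g ∈ C²(Γ)` and `g_z < 0` in `Γ`. -/
structure IsGeneratingFunction (g : Vec n × Vec n × ℝ → ℝ) (Γ : Set (Vec n × Vec n × ℝ)) :
    Prop where
  isOpen : IsOpen Γ
  isConnected : IsConnected Γ
  interval : ∀ x y : Vec n, {z : ℝ | (x, y, z) ∈ Γ}.OrdConnected
  contDiffOn : ContDiffOn ℝ 2 g Γ
  gz_neg : ∀ x y z, (x, y, z) ∈ Γ → gz g x y z < 0

/-- `𝒰 = {(x, g(x,y,z), g_x(x,y,z)) | (x,y,z) ∈ Γ}`. -/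
def jetSet (g : Vec n × Vec n × ℝ → ℝ) (Γ : Set (Vec n × Vec n × ℝ)) : Set (Vec n × ℝ × Vec n) :=
  {q | ∃ x y z, (x, y, z) ∈ Γ ∧ q = (x, g (x, y, z), gx g x y z)}

/-- `𝒰(x, u) = {p | (x, u, p) ∈ 𝒰}`. -/
def jetFiber (g : Vec n × Vec n × ℝ → ℝ) (Γ : Set (Vec n × Vec n × ℝ)) (x : Vec n) (u : ℝ) :
    Set (Vec n) :=
  {p | (x, u, p) ∈ jetSet g Γ}

/-- Condition A1. -/
def CondA1 (g : Vec n × Vec n × ℝ → ℝ) (Γ : Set (Vec n × Vec n × ℝ)) : Prop :=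
  ∀ x u p, (x, u, p) ∈ jetSet g Γ →
    ∃! yz : Vec n × ℝ, (x, yz.1, yz.2) ∈ Γ ∧ g (x, yz.1, yz.2) = u ∧ gx g x yz.1 yz.2 = p

/-- Condition A2. -/
def CondA2 (g : Vec n × Vec n × ℝ → ℝ) (Γ : Set (Vec n × Vec n × ℝ)) : Prop :=
  ∀ x y z, (x, y, z) ∈ Γ → (matE g x y z).det ≠ 0

/-- Condition A1*. -/
def CondA1Star (g : Vec n × Vec n × ℝ → ℝ) (Γ : Set (Vec n × Vec n × ℝ)) : Prop :=
  ∀ y z, Set.InjOn (fun x => mapQ g x y z) {x | (x, y, z) ∈ Γ}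

open Classical in
/-- The pair `(Y(x,u,p), Z(x,u,p))`: a solution `(y, z)` of `g(x,y,z) = u`, `g_x(x,y,z) = p` with
`(x,y,z) ∈ Γ`. For `(x,u,p) ∈ 𝒰` it exists, and it is unique under condition A1; the value outside
`𝒰` is irrelevant. -/
def mapYZ (g : Vec n × Vec n × ℝ → ℝ) (Γ : Set (Vec n × Vec n × ℝ)) (x : Vec n) (u : ℝ)
    (p : Vec n) : Vec n × ℝ :=
  if h : ∃ yz : Vec n × ℝ, (x, yz.1, yz.2) ∈ Γ ∧ g (x, yz.1, yz.2) = u ∧ gx g x yz.1 yz.2 = p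
  then h.choose else 0

/-- The quadratic form `(A(x,u,p) ξ, ξ)`, where `A(x,u,p) = g_xx(x, Y(x,u,p), Z(x,u,p))`. -/
def formA (g : Vec n × Vec n × ℝ → ℝ) (Γ : Set (Vec n × Vec n × ℝ)) (x : Vec n) (u : ℝ)
    (p ξ : Vec n) : ℝ :=
  gxxForm g x (mapYZ g Γ x u p).1 (mapYZ g Γ x u p).2 ξ

/-- Condition A3w: `(A ξ, ξ)(x, u, ·)` is convex along line segments in `𝒰(x, u)` orthogonal
to `ξ`. -/
def CondA3w (g : Vec n × Vec n × ℝ → ℝ) (Γ : Set (Vec n × Vec n × ℝ)) : Prop :=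
  ∀ (x : Vec n) (u : ℝ) (ξ p₀ p₁ : Vec n), segment ℝ p₀ p₁ ⊆ jetFiber g Γ x u →
    inner ℝ ξ (p₁ - p₀) = 0 →
    ConvexOn ℝ (segment ℝ p₀ p₁) (fun p => formA g Γ x u p ξ)

/-- `Γ* = {(x, y, g(x,y,z)) | (x,y,z) ∈ Γ}`. -/
def dualDomain (g : Vec n × Vec n × ℝ → ℝ) (Γ : Set (Vec n × Vec n × ℝ)) :
    Set (Vec n × Vec n × ℝ) :=
  {q | ∃ x y z, (x, y, z) ∈ Γ ∧ q = (x, y, g (x, y, z))}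

open Classical in
/-- The dual generating function `g*(x,y,u)` on `Γ*`: the solution `z` of `g(x,y,z) = u` with
`(x,y,z) ∈ Γ`, unique because `g_z < 0`; the value outside `Γ*` is irrelevant. -/
def gStar (g : Vec n × Vec n × ℝ → ℝ) (Γ : Set (Vec n × Vec n × ℝ)) (x y : Vec n) (u : ℝ) : ℝ :=
  if h : ∃ z, (x, y, z) ∈ Γ ∧ g (x, y, z) = u then h.choose else 0

/-- A set `S` is `g`-convex with respect to `(y₀, z₀)`: `(S, y₀, z₀) ⊆ Γ` and the image of `S`
under `Q(·, y₀, z₀)` is convex. -/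
def IsGConvexSet (g : Vec n × Vec n × ℝ → ℝ) (Γ : Set (Vec n × Vec n × ℝ)) (S : Set (Vec n))
    (y₀ : Vec n) (z₀ : ℝ) : Prop :=
  (∀ x ∈ S, (x, y₀, z₀) ∈ Γ) ∧ Convex ℝ ((fun x => mapQ g x y₀ z₀) '' S)

/-- `u ∈ C⁰(Ω)` is `g`-convex in `Ω`: it has a `g`-support on `Ω` at every point of `Ω`. -/
def IsGConvexFun (g : Vec n × Vec n × ℝ → ℝ) (Γ : Set (Vec n × Vec n × ℝ)) (Ω : Set (Vec n))
    (u : Vec n → ℝ) : Prop :=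
  ContinuousOn u Ω ∧
    ∀ x₀ ∈ Ω, ∃ (y₀ : Vec n) (z₀ : ℝ), (∀ x ∈ Ω, (x, y₀, z₀) ∈ Γ) ∧
      u x₀ = g (x₀, y₀, z₀) ∧ ∀ x ∈ Ω, g (x, y₀, z₀) ≤ u x

/-- The `g`-normal mapping `Tu(x₀)` of `u` on `Ω`: the set of those `y` for which
`z = g*(x₀, y, u(x₀))` is defined, `(Ω, y, z) ⊆ Γ` and `u ≥ g(·, y, z)` in `Ω`. -/
def gNormal (g : Vec n × Vec n × ℝ → ℝ) (Γ : Set (Vec n × Vec n × ℝ)) (Ω : Set (Vec n))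
    (u : Vec n → ℝ) (x₀ : Vec n) : Set (Vec n) :=
  {y | (x₀, y, u x₀) ∈ dualDomain g Γ ∧
    (∀ x ∈ Ω, (x, y, gStar g Γ x₀ y (u x₀)) ∈ Γ) ∧
    ∀ x ∈ Ω, g (x, y, gStar g Γ x₀ y (u x₀)) ≤ u x}

/-- The (open) section `S(u, g₀)`, `g₀ = g(·, y₀, z₀)`. -/
def gSection (g : Vec n × Vec n × ℝ → ℝ) (Ω : Set (Vec n)) (u : Vec n → ℝ) (y₀ : Vec n) (z₀ : ℝ) :
    Set (Vec n) :=
  {x | x ∈ Ω ∧ u x < g (x, y₀, z₀)}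

/-- The closed section `S̃(u, g₀)`, `g₀ = g(·, y₀, z₀)`. -/
def gClosedSection (g : Vec n × Vec n × ℝ → ℝ) (Ω : Set (Vec n)) (u : Vec n → ℝ) (y₀ : Vec n)
    (z₀ : ℝ) : Set (Vec n) :=
  {x | x ∈ Ω ∧ u x ≤ g (x, y₀, z₀)}

end GenConvex

end

noncomputable section

namespace GenConvex

variable {n : ℕ}

open Filter Topology Set

/-! Let g(·, y₁, z₁) support u at x. Since g_z < 0, comparing it with g₀ at x' amounts to comparing
z₁ with the level lev(x') at which g(x', y₁, ·) equals g₀(x') (`contactLevel`). So both sections are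
g-convex once lev is quasiconvex along segments in the coordinates Q(·, y₀, z₀); this is
`level_le_max`.

Quasiconvexity follows from local supporting hyperplanes (`exists_local_support`), and these from a
local form of Loeper's maximum principle (`eventually_gSegment_le`). Join (y₀, z₀) to (y₁, lev a) by
the g-segment based at a: the generating functions through (a, g₀(a)) whose gradients there fill a
line segment. If x is near a and lev x ≤ lev a, none of them exceeds g₀ at x. They start from g₀, so
their derivative in t at t = 0 is nonpositive at x. That derivative is g_z times a function affine
in Q(x) and vanishing at Q(a), which gives a half-space.

The maximum principle is proved by also varying the base point x'. The value at x of the g-segment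
based at x', minus κ‖x' − x‖², is maximised over x' and t. A maximum above g₀(x) would be interior
in t, so stationary in t. Then A3w yields a direction w, orthogonal to the gap between the two end
gradients and pointing towards x, along which the value does not decrease to first order, while the
penalty strictly improves (`exists_ascent`). This is a contradiction; finally κ → 0. Only A3w in
first-difference form is used, so g ∈ C² suffices. -/

/-- The linear map sending a covector on `ℝⁿ × ℝⁿ × ℝ` to the vector that represents its restriction
to the first factor. -/
def firstGrad (n : ℕ) : ((Vec n × Vec n × ℝ) →L[ℝ] ℝ) →L[ℝ] Vec n :=
  ((EuclideanSpace.equiv (Fin n) ℝ).symm : (Fin n → ℝ) →L[ℝ] Vec n) ∘L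
    ContinuousLinearMap.pi fun i =>
      ContinuousLinearMap.apply ℝ ℝ ((EuclideanSpace.single i 1, 0, 0) : Vec n × Vec n × ℝ)

theorem firstGrad_apply (φ : (Vec n × Vec n × ℝ) →L[ℝ] ℝ) (i : Fin n) :
    firstGrad n φ i = φ (EuclideanSpace.single i 1, 0, 0) :=
  rfl

theorem eq_sum_single (q : Vec n) : q = ∑ j, q j • EuclideanSpace.single j (1 : ℝ) := by
  ext k
  simp [Pi.single_apply]

theorem inner_firstGrad (φ : (Vec n × Vec n × ℝ) →L[ℝ] ℝ) (h : Vec n) :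
    inner ℝ (firstGrad n φ) h = φ (h, 0, 0) := by
  have h1 : ((h, 0, 0) : Vec n × Vec n × ℝ) =
      ∑ j, h j • ((EuclideanSpace.single j 1, 0, 0) : Vec n × Vec n × ℝ) := by
    refine Prod.ext ?_ (Prod.ext ?_ ?_)
    · simp only [Prod.fst_sum, Prod.smul_mk]
      exact eq_sum_single h
    · simp [Prod.snd_sum]
    · simp [Prod.snd_sum]
  rw [h1, map_sum]
  simp only [map_smul, smul_eq_mul]
  simp [PiLp.inner_apply, firstGrad_apply]

/-- The second derivative of `g` on the full space. -/
abbrev hess (g : Vec n × Vec n × ℝ → ℝ) (a : Vec n × Vec n × ℝ) :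
    (Vec n × Vec n × ℝ) →L[ℝ] (Vec n × Vec n × ℝ) →L[ℝ] ℝ :=
  fderiv ℝ (fderiv ℝ g) a

theorem eventually_mem_slice {α : Type*} [TopologicalSpace α] {Γ : Set (Vec n × α)}
    (hΓ : IsOpen Γ) {x : Vec n} {c : α} (h : (x, c) ∈ Γ) : ∀ᶠ x' in 𝓝 x, (x', c) ∈ Γ := by
  have : ContinuousAt (fun x' : Vec n => (x', c)) x := by fun_prop
  exact this.eventually_mem (hΓ.mem_nhds h)

/-! ### Derivatives of g in terms of the full first and second derivative, and the role of E. -/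

section Smooth

variable {g : Vec n × Vec n × ℝ → ℝ} {Γ : Set (Vec n × Vec n × ℝ)}

theorem IsGeneratingFunction.contDiffAt (hg : IsGeneratingFunction g Γ) {a} (ha : a ∈ Γ) :
    ContDiffAt ℝ 2 g a :=
  hg.contDiffOn.contDiffAt (hg.isOpen.mem_nhds ha)

theorem IsGeneratingFunction.hasStrictFDerivAt (hg : IsGeneratingFunction g Γ) {a} (ha : a ∈ Γ) :
    HasStrictFDerivAt g (fderiv ℝ g a) a :=
  (hg.contDiffAt ha).hasStrictFDerivAt (by norm_num)

theorem IsGeneratingFunction.contDiffAt_fderiv (hg : IsGeneratingFunction g Γ) {a}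
    (ha : a ∈ Γ) : ContDiffAt ℝ 1 (fderiv ℝ g) a :=
  (hg.contDiffAt ha).fderiv_right (by norm_num)

theorem IsGeneratingFunction.hasStrictFDerivAt_fderiv (hg : IsGeneratingFunction g Γ) {a}
    (ha : a ∈ Γ) : HasStrictFDerivAt (fderiv ℝ g) (hess g a) a :=
  (hg.contDiffAt_fderiv ha).hasStrictFDerivAt (by norm_num)

theorem IsGeneratingFunction.continuousAt_hess (hg : IsGeneratingFunction g Γ) {a}
    (ha : a ∈ Γ) : ContinuousAt (hess g) a :=
  ((hg.contDiffAt_fderiv ha).fderiv_right (m := 0) (by norm_num)).continuousAt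

theorem IsGeneratingFunction.hess_symm (hg : IsGeneratingFunction g Γ) {a}
    (ha : a ∈ Γ) (v w) : hess g a v w = hess g a w v :=
  ((hg.contDiffAt ha).isSymmSndFDerivAt (by simp)) v w

theorem IsGeneratingFunction.gx_eq (hg : IsGeneratingFunction g Γ) {x y z} (ha : (x, y, z) ∈ Γ) :
    gx g x y z = firstGrad n (fderiv ℝ g (x, y, z)) := by
  refine ext_inner_right ℝ fun h => ?_
  rw [inner_firstGrad, gx, gradient, InnerProductSpace.toDual_symm_apply]
  have h1 : HasFDerivAt (fun x' : Vec n => (x', y, z))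
      (ContinuousLinearMap.inl ℝ (Vec n) (Vec n × ℝ)) x :=
    hasFDerivAt_prodMk_left x (y, z)
  have h2 := (hg.hasStrictFDerivAt ha).hasFDerivAt.comp x h1
  rw [show (fun x' => g (x', y, z)) = g ∘ fun x' => (x', y, z) from rfl, h2.fderiv]
  rfl

theorem IsGeneratingFunction.inner_gx (hg : IsGeneratingFunction g Γ) {x y z}
    (ha : (x, y, z) ∈ Γ) (h : Vec n) :
    inner ℝ (gx g x y z) h = fderiv ℝ g (x, y, z) (h, 0, 0) := by
  rw [hg.gx_eq ha, inner_firstGrad]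

theorem IsGeneratingFunction.inner_gy (hg : IsGeneratingFunction g Γ) {x y z}
    (ha : (x, y, z) ∈ Γ) (h : Vec n) :
    inner ℝ (gy g x y z) h = fderiv ℝ g (x, y, z) (0, h, 0) := by
  rw [gy, gradient, InnerProductSpace.toDual_symm_apply]
  have h1 : HasFDerivAt (fun y' : Vec n => (x, y', z))
      ((ContinuousLinearMap.inr ℝ (Vec n) (Vec n × ℝ)).comp
        (ContinuousLinearMap.inl ℝ (Vec n) ℝ)) y :=
    (hasFDerivAt_prodMk_right x (y, z)).comp y (hasFDerivAt_prodMk_left y z)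
  have h2 := (hg.hasStrictFDerivAt ha).hasFDerivAt.comp y h1
  rw [show (fun y' => g (x, y', z)) = g ∘ fun y' => (x, y', z) from rfl, h2.fderiv]
  rfl

theorem IsGeneratingFunction.hasDerivAt_z (hg : IsGeneratingFunction g Γ) {x y z}
    (ha : (x, y, z) ∈ Γ) :
    HasDerivAt (fun z' => g (x, y, z')) (fderiv ℝ g (x, y, z) (0, 0, 1)) z := by
  have h1 : HasFDerivAt (fun z' : ℝ => (x, y, z'))
      ((ContinuousLinearMap.inr ℝ (Vec n) (Vec n × ℝ)).comp
        (ContinuousLinearMap.inr ℝ (Vec n) ℝ)) z :=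
    (hasFDerivAt_prodMk_right x (y, z)).comp z (hasFDerivAt_prodMk_right y z)
  have h2 := (hg.hasStrictFDerivAt ha).hasFDerivAt.comp z h1
  exact h2.hasDerivAt

theorem IsGeneratingFunction.gz_eq (hg : IsGeneratingFunction g Γ) {x y z}
    (ha : (x, y, z) ∈ Γ) : gz g x y z = fderiv ℝ g (x, y, z) (0, 0, 1) :=
  (hg.hasDerivAt_z ha).deriv

theorem IsGeneratingFunction.fderiv_z_neg (hg : IsGeneratingFunction g Γ) {a}
    (ha : a ∈ Γ) : fderiv ℝ g a (0, 0, 1) < 0 := by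
  obtain ⟨x, y, z⟩ := a
  rw [← hg.gz_eq ha]
  exact hg.gz_neg x y z ha

theorem prod_decomp (a : Vec n) (b : Vec n) (c : ℝ) :
    (a, b, c) = (a, 0, 0) + (0, b, 0) + c • ((0, 0, 1) : Vec n × Vec n × ℝ) := by
  simp

theorem IsGeneratingFunction.fderiv_apply (hg : IsGeneratingFunction g Γ) {x y z}
    (ha : (x, y, z) ∈ Γ) (p q : Vec n) (r : ℝ) :
    fderiv ℝ g (x, y, z) (p, q, r) =
      inner ℝ (gx g x y z) p + inner ℝ (gy g x y z) q + gz g x y z * r := by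
  rw [prod_decomp p q r, map_add, map_add, map_smul, hg.inner_gx ha, hg.inner_gy ha,
    hg.gz_eq ha, smul_eq_mul, mul_comm r]

/-- `g_x` as a function on the full space. -/
abbrev gxFun (g : Vec n × Vec n × ℝ → ℝ) (a : Vec n × Vec n × ℝ) : Vec n :=
  gx g a.1 a.2.1 a.2.2

theorem IsGeneratingFunction.hasStrictFDerivAt_gx (hg : IsGeneratingFunction g Γ) {a}
    (ha : a ∈ Γ) : HasStrictFDerivAt (gxFun g) (firstGrad n ∘L hess g a) a := by
  have h1 := (firstGrad n).hasStrictFDerivAt.comp a (hg.hasStrictFDerivAt_fderiv ha)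
  refine h1.congr_of_eventuallyEq ?_
  filter_upwards [hg.isOpen.mem_nhds ha] with b hb
  exact (hg.gx_eq (x := b.1) (y := b.2.1) (z := b.2.2) hb).symm

theorem IsGeneratingFunction.gxxForm_eq (hg : IsGeneratingFunction g Γ) {x y z}
    (ha : (x, y, z) ∈ Γ) (ξ : Vec n) :
    gxxForm g x y z ξ = hess g (x, y, z) (ξ, 0, 0) (ξ, 0, 0) := by
  have hev : (fderiv ℝ fun x' => g (x', y, z)) =ᶠ[𝓝 x]
      fun x' => ((ContinuousLinearMap.compL ℝ (Vec n) (Vec n × Vec n × ℝ) ℝ).flip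
        (ContinuousLinearMap.inl ℝ (Vec n) (Vec n × ℝ))) (fderiv ℝ g (x', y, z)) := by
    filter_upwards [eventually_mem_slice hg.isOpen ha] with x' hx'
    have h2 := (hg.hasStrictFDerivAt hx').hasFDerivAt.comp x'
      (hasFDerivAt_prodMk_left (𝕜 := ℝ) x' (y, z))
    exact h2.fderiv
  have h3 := (hg.hasStrictFDerivAt_fderiv ha).hasFDerivAt.comp x
    (hasFDerivAt_prodMk_left (𝕜 := ℝ) x (y, z))
  have h4 := (((ContinuousLinearMap.compL ℝ (Vec n) (Vec n × Vec n × ℝ) ℝ).flip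
        (ContinuousLinearMap.inl ℝ (Vec n) (Vec n × ℝ))).hasFDerivAt).comp x h3
  rw [gxxForm, hev.fderiv_eq]
  exact congrArg (fun L : Vec n →L[ℝ] Vec n →L[ℝ] ℝ => L ξ ξ) h4.fderiv

theorem IsGeneratingFunction.matE_apply (hg : IsGeneratingFunction g Γ) {x y z}
    (ha : (x, y, z) ∈ Γ) (i j : Fin n) :
    matE g x y z i j = hess g (x, y, z) (0, EuclideanSpace.single j 1, 0)
        (EuclideanSpace.single i 1, 0, 0) - (gz g x y z)⁻¹ *
        hess g (x, y, z) (0, 0, 1) (EuclideanSpace.single i 1, 0, 0) * gy g x y z j := by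
  have hp : ∀ a, HasFDerivAt (fun v : Vec n => v i)
      (EuclideanSpace.proj i : Vec n →L[ℝ] ℝ) a := fun a =>
    (EuclideanSpace.proj i : Vec n →L[ℝ] ℝ).hasFDerivAt
  have h0 := (hp _).comp _ (hg.hasStrictFDerivAt_gx ha).hasFDerivAt
  have h1 : HasFDerivAt (fun y' : Vec n => (x, y', z))
      ((ContinuousLinearMap.inr ℝ (Vec n) (Vec n × ℝ)).comp
        (ContinuousLinearMap.inl ℝ (Vec n) ℝ)) y :=
    (hasFDerivAt_prodMk_right x (y, z)).comp y (hasFDerivAt_prodMk_left y z)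
  have h2 : HasFDerivAt (fun z' : ℝ => (x, y, z'))
      ((ContinuousLinearMap.inr ℝ (Vec n) (Vec n × ℝ)).comp
        (ContinuousLinearMap.inr ℝ (Vec n) ℝ)) z :=
    (hasFDerivAt_prodMk_right x (y, z)).comp z (hasFDerivAt_prodMk_right y z)
  have h3 := h0.comp y h1
  have h4 := h0.comp z h2
  have e1 := h3.fderiv
  have e2 := h4.hasDerivAt.deriv
  change fderiv ℝ (fun y' => gx g x y' z i) y = _ at e1
  change deriv (fun z' => gx g x y z' i) z = _ at e2
  rw [matE, Matrix.of_apply, e1, e2]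
  rfl

/-- The `(y, z)`-part of the derivative of `(x, y, z) ↦ (g, g_x)` is injective. -/
theorem IsGeneratingFunction.eq_zero_of_jet (hg : IsGeneratingFunction g Γ) (hA2 : CondA2 g Γ)
    {x y z} (ha : (x, y, z) ∈ Γ) {q : Vec n} {r : ℝ}
    (h1 : fderiv ℝ g (x, y, z) (0, q, r) = 0)
    (h2 : firstGrad n (hess g (x, y, z) (0, q, r)) = 0) : q = 0 ∧ r = 0 := by
  have hz := (hg.gz_neg x y z ha).ne
  rw [hg.fderiv_apply ha, inner_zero_right, zero_add] at h1
  -- Stationarity of g determines r from q; substituting it into the variation of g_x leaves exactly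
  -- E q.
  have hr : r = -((gz g x y z)⁻¹ * inner ℝ (gy g x y z) q) := by
    field_simp
    linarith
  have hq : (matE g x y z).mulVec q.ofLp = 0 := by
    ext i
    have h3 : firstGrad n (hess g (x, y, z) (0, q, r)) i = 0 := by rw [h2]; rfl
    rw [firstGrad_apply] at h3
    have h4 : ((0, q, r) : Vec n × Vec n × ℝ) =
        ∑ j, q j • ((0, EuclideanSpace.single j 1, 0) : Vec n × Vec n × ℝ) +
          r • ((0, 0, 1) : Vec n × Vec n × ℝ) := by
      refine Prod.ext ?_ (Prod.ext ?_ ?_)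
      · simp [Prod.fst_sum]
      · simp only [Prod.snd_add, Prod.fst_add, Prod.snd_sum, Prod.fst_sum, Prod.smul_mk, smul_zero,
          add_zero]
        exact eq_sum_single q
      · simp [Prod.snd_sum]
    rw [h4, map_add, map_sum, add_apply, sum_apply] at h3
    simp only [map_smul, smul_apply, smul_eq_mul] at h3
    rw [Matrix.mulVec, dotProduct, Pi.zero_apply]
    simp only [hg.matE_apply ha]
    have h6 : inner ℝ (gy g x y z) q = ∑ j, gy g x y z j * q j := by
      simp [PiLp.inner_apply, mul_comm]
    rw [hr, h6, Finset.mul_sum, neg_mul, Finset.sum_mul, ← sub_eq_add_neg,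
      ← Finset.sum_sub_distrib] at h3
    refine Eq.trans (Finset.sum_congr rfl fun j _ => ?_) h3
    ring
  have hq0 := Matrix.eq_zero_of_mulVec_eq_zero (hA2 x y z ha) hq
  have hq1 : q = 0 := by
    ext i
    exact congrFun hq0 i
  refine ⟨hq1, ?_⟩
  rw [hr, hq1]
  simp

end Smooth

/-! ### Inverting the jet map: regularity of (Y, Z) and of g*. -/

/-- A left inverse of a map with invertible strict derivative on an open set is strictly
differentiable, and the image of that set is a neighbourhood. -/
theorem hasStrictFDerivAt_leftInvOn {E F : Type*} [NormedAddCommGroup E] [NormedSpace ℝ E]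
    [CompleteSpace E] [NormedAddCommGroup F] [NormedSpace ℝ F] {f : E → F} {f' : E ≃L[ℝ] F}
    {S : Set E} (hS : IsOpen S) {h : F → E} {a : E} (ha : a ∈ S)
    (hf : HasStrictFDerivAt f (f' : E →L[ℝ] F) a) (hinv : ∀ x ∈ S, h (f x) = x) :
    HasStrictFDerivAt h (f'.symm : F →L[ℝ] E) (f a) ∧ f '' S ∈ 𝓝 (f a) := by
  have hmap := hf.map_nhds_eq_of_equiv
  have hS' := hS.mem_nhds ha
  refine ⟨?_, by rw [← hmap]; exact image_mem_map hS'⟩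
  refine HasStrictFDerivAt.of_local_left_inverse (f := f) ?_ (by rwa [hinv a ha]) ?_
  -- The neighbourhood filter of `f a` is the image of that of `a`, where `h ∘ f` is the identity;
  -- hence `h` is continuous at `f a`.
  · rw [ContinuousAt, hinv a ha, ← hmap, tendsto_map'_iff]
    refine tendsto_id.congr' ?_
    filter_upwards [hS'] with x hx
    exact (hinv x hx).symm
  · rw [← hmap, eventually_map]
    filter_upwards [hS'] with x hx
    rw [hinv x hx]

theorem exists_continuousLinearEquiv_of_injective {E F : Type*} [NormedAddCommGroup E]
    [NormedSpace ℝ E] [FiniteDimensional ℝ E] [NormedAddCommGroup F] [NormedSpace ℝ F]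
    [FiniteDimensional ℝ F] (A : E →L[ℝ] F) (hA : ∀ v, A v = 0 → v = 0)
    (hdim : Module.finrank ℝ E = Module.finrank ℝ F) :
    ∃ L : E ≃L[ℝ] F, (L : E →L[ℝ] F) = A := by
  have hinj : Function.Injective (A : E →ₗ[ℝ] F) := by
    rw [← LinearMap.ker_eq_bot, LinearMap.ker_eq_bot']
    exact hA
  exact ⟨(LinearMap.linearEquivOfInjective _ hinj hdim).toContinuousLinearEquiv,
    ContinuousLinearMap.ext fun _ => rfl⟩

variable {g : Vec n × Vec n × ℝ → ℝ} {Γ : Set (Vec n × Vec n × ℝ)}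

/-- The map `(x, y, z) ↦ (x, g, g_x)`. -/
def jet (g : Vec n × Vec n × ℝ → ℝ) (a : Vec n × Vec n × ℝ) : Vec n × ℝ × Vec n :=
  (a.1, g a, gxFun g a)

/-- The derivative of `jet`. -/
def jetDeriv (g : Vec n × Vec n × ℝ → ℝ) (a : Vec n × Vec n × ℝ) :
    (Vec n × Vec n × ℝ) →L[ℝ] (Vec n × ℝ × Vec n) :=
  (ContinuousLinearMap.fst ℝ (Vec n) (Vec n × ℝ)).prod
    ((fderiv ℝ g a).prod (firstGrad n ∘L hess g a))

theorem jetDeriv_apply (a ω : Vec n × Vec n × ℝ) :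
    jetDeriv g a ω = (ω.1, fderiv ℝ g a ω, firstGrad n (hess g a ω)) :=
  rfl

theorem IsGeneratingFunction.hasStrictFDerivAt_jet (hg : IsGeneratingFunction g Γ) {a}
    (ha : a ∈ Γ) : HasStrictFDerivAt (jet g) (jetDeriv g a) a :=
  hasStrictFDerivAt_fst.prodMk ((hg.hasStrictFDerivAt ha).prodMk (hg.hasStrictFDerivAt_gx ha))

theorem IsGeneratingFunction.exists_jetEquiv (hg : IsGeneratingFunction g Γ) (hA2 : CondA2 g Γ)
    {a} (ha : a ∈ Γ) : ∃ L : (Vec n × Vec n × ℝ) ≃L[ℝ] (Vec n × ℝ × Vec n),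
      (L : (Vec n × Vec n × ℝ) →L[ℝ] (Vec n × ℝ × Vec n)) = jetDeriv g a := by
  refine exists_continuousLinearEquiv_of_injective _ ?_ ?_
  · rintro ⟨p, q, r⟩ h
    rw [jetDeriv_apply, Prod.mk_eq_zero, Prod.mk_eq_zero] at h
    obtain ⟨h0, h1, h2⟩ := h
    change p = 0 at h0
    subst h0
    obtain ⟨x, y, z⟩ := a
    obtain ⟨rfl, rfl⟩ := hg.eq_zero_of_jet hA2 ha h1 h2
    rfl
  · simp only [Module.finrank_prod]
    ring

/-- The vector `(0, ẏ, ż)` along which `g` is stationary and `g_x` has derivative `k`. -/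
theorem IsGeneratingFunction.exists_lift (hg : IsGeneratingFunction g Γ) (hA2 : CondA2 g Γ)
    {a} (ha : a ∈ Γ) (k : Vec n) : ∃ ω : Vec n × ℝ, fderiv ℝ g a (0, ω) = 0 ∧
      firstGrad n (hess g a (0, ω)) = k := by
  obtain ⟨L, hL⟩ := hg.exists_jetEquiv hA2 ha
  have h : jetDeriv g a (L.symm (0, 0, k)) = (0, 0, k) := by
    rw [← hL]
    exact L.apply_symm_apply _
  rw [jetDeriv_apply, Prod.mk.injEq, Prod.mk.injEq] at h
  obtain ⟨h0, h1, h2⟩ := h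
  have h3 : ((0, (L.symm (0, 0, k)).2) : Vec n × Vec n × ℝ) = L.symm (0, 0, k) :=
    Prod.ext h0.symm rfl
  exact ⟨(L.symm (0, 0, k)).2, by rw [h3, h1], by rw [h3, h2]⟩

theorem mem_jetSet_of_mem {a} (ha : a ∈ Γ) : jet g a ∈ jetSet g Γ :=
  ⟨a.1, a.2.1, a.2.2, ha, rfl⟩

theorem mapYZ_spec {x : Vec n} {u : ℝ} {p : Vec n} (h : (x, u, p) ∈ jetSet g Γ) :
    (x, mapYZ g Γ x u p) ∈ Γ ∧ g (x, mapYZ g Γ x u p) = u ∧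
      gxFun g (x, mapYZ g Γ x u p) = p := by
  obtain ⟨x', y, z, ha, he⟩ := h
  rw [Prod.mk.injEq, Prod.mk.injEq] at he
  obtain ⟨rfl, rfl, rfl⟩ := he
  have hex : ∃ yz : Vec n × ℝ, (x, yz.1, yz.2) ∈ Γ ∧ g (x, yz.1, yz.2) = g (x, y, z) ∧
      gx g x yz.1 yz.2 = gx g x y z := ⟨(y, z), ha, rfl, rfl⟩
  rw [mapYZ, dif_pos hex]
  exact hex.choose_spec

theorem CondA1.mapYZ_eq (hA1 : CondA1 g Γ) {a} (ha : a ∈ Γ) :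
    mapYZ g Γ a.1 (g a) (gxFun g a) = a.2 := by
  have hm := mem_jetSet_of_mem (g := g) ha
  exact (hA1 _ _ _ hm).unique (mapYZ_spec hm) ⟨ha, rfl, rfl⟩

/-- A2 makes the derivative of `jet` invertible, and A1 makes `mapYZ` a left inverse on all of Γ, so
no local branch has to be chosen. That 𝒰 is a neighbourhood allows the defining identities of (Y, Z)
to be differentiated. -/
theorem IsGeneratingFunction.mapYZ_regular (hg : IsGeneratingFunction g Γ) (hA1 : CondA1 g Γ)
    (hA2 : CondA2 g Γ) {q : Vec n × ℝ × Vec n} (hq : q ∈ jetSet g Γ) :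
    (∃ L : (Vec n × ℝ × Vec n) →L[ℝ] (Vec n × ℝ),
        HasStrictFDerivAt (fun q : Vec n × ℝ × Vec n => mapYZ g Γ q.1 q.2.1 q.2.2) L q) ∧
      jetSet g Γ ∈ 𝓝 q := by
  obtain ⟨x, y, z, ha, rfl⟩ := hq
  obtain ⟨L, hL⟩ := hg.exists_jetEquiv hA2 ha
  have hd := hg.hasStrictFDerivAt_jet ha
  rw [← hL] at hd
  have h := hasStrictFDerivAt_leftInvOn hg.isOpen
    (h := fun q : Vec n × ℝ × Vec n => (q.1, mapYZ g Γ q.1 q.2.1 q.2.2)) ha hd fun a ha => by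
      change (a.1, mapYZ g Γ a.1 (g a) (gxFun g a)) = a
      rw [hA1.mapYZ_eq ha]
  refine ⟨⟨_, hasStrictFDerivAt_snd.comp _ h.1⟩, mem_of_superset h.2 ?_⟩
  rintro _ ⟨b, hb, rfl⟩
  exact mem_jetSet_of_mem hb

theorem IsGeneratingFunction.strictAntiOn (hg : IsGeneratingFunction g Γ) (x y : Vec n) :
    StrictAntiOn (fun z => g (x, y, z)) {z | (x, y, z) ∈ Γ} := by
  refine strictAntiOn_of_deriv_neg (hg.interval x y).convex ?_ ?_
  · intro z hz
    exact (hg.hasDerivAt_z hz).continuousAt.continuousWithinAt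
  · intro z hz
    have hz' : z ∈ {z | (x, y, z) ∈ Γ} := interior_subset hz
    exact hg.gz_neg x y z hz'

theorem gStar_spec {x y : Vec n} {u : ℝ} (h : (x, y, u) ∈ dualDomain g Γ) :
    (x, y, gStar g Γ x y u) ∈ Γ ∧ g (x, y, gStar g Γ x y u) = u := by
  obtain ⟨x', y', z, ha, he⟩ := h
  rw [Prod.mk.injEq, Prod.mk.injEq] at he
  obtain ⟨rfl, rfl, rfl⟩ := he
  have hex : ∃ z', (x, y, z') ∈ Γ ∧ g (x, y, z') = g (x, y, z) := ⟨z, ha, rfl⟩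
  rw [gStar, dif_pos hex]
  exact hex.choose_spec

theorem mem_dualDomain {x y z} (ha : (x, y, z) ∈ Γ) : (x, y, g (x, y, z)) ∈ dualDomain g Γ :=
  ⟨x, y, z, ha, rfl⟩

theorem IsGeneratingFunction.gStar_eq (hg : IsGeneratingFunction g Γ) {x y z}
    (ha : (x, y, z) ∈ Γ) : gStar g Γ x y (g (x, y, z)) = z := by
  have h := gStar_spec (mem_dualDomain (g := g) ha)
  exact (hg.strictAntiOn x y).injOn h.1 ha h.2

/-- The same inversion with y frozen, applied to (x, z) ↦ (x, g(x, y, z)); here g_z ≠ 0 replaces A2.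
-/
theorem IsGeneratingFunction.gStar_regular (hg : IsGeneratingFunction g Γ) {x y u}
    (h : (x, y, u) ∈ dualDomain g Γ) :
    ∃ L : (Vec n × ℝ) →L[ℝ] ℝ, HasStrictFDerivAt (fun q : Vec n × ℝ => gStar g Γ q.1 y q.2) L (x, u) := by
  obtain ⟨x', y', z, ha, he⟩ := h
  rw [Prod.mk.injEq, Prod.mk.injEq] at he
  obtain ⟨rfl, rfl, rfl⟩ := he
  have hι : ∀ q : Vec n × ℝ, HasStrictFDerivAt (fun q : Vec n × ℝ => (q.1, y, q.2))
      ((ContinuousLinearMap.fst ℝ (Vec n) ℝ).prod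
        ((0 : (Vec n × ℝ) →L[ℝ] Vec n).prod (ContinuousLinearMap.snd ℝ (Vec n) ℝ))) q := fun q =>
    hasStrictFDerivAt_fst.prodMk ((hasStrictFDerivAt_const y q).prodMk hasStrictFDerivAt_snd)
  have hf : HasStrictFDerivAt (fun q : Vec n × ℝ => (q.1, g (q.1, y, q.2))) _ (x, z) :=
    hasStrictFDerivAt_fst.prodMk ((hg.hasStrictFDerivAt ha).comp (x, z) (hι (x, z)))
  set A := (ContinuousLinearMap.fst ℝ (Vec n) ℝ).prod ((fderiv ℝ g (x, y, z)).comp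
    ((ContinuousLinearMap.fst ℝ (Vec n) ℝ).prod
        ((0 : (Vec n × ℝ) →L[ℝ] Vec n).prod (ContinuousLinearMap.snd ℝ (Vec n) ℝ)))) with hA
  obtain ⟨L, hL⟩ := exists_continuousLinearEquiv_of_injective A (by
    rintro ⟨p, r⟩ h
    change (p, fderiv ℝ g (x, y, z) (p, 0, r)) = 0 at h
    rw [Prod.mk_eq_zero] at h
    obtain ⟨rfl, h1⟩ := h
    rw [hg.fderiv_apply ha] at h1
    simpa [(hg.gz_neg x y z ha).ne] using h1) rfl
  rw [← hL] at hf
  have hS : IsOpen {q : Vec n × ℝ | (q.1, y, q.2) ∈ Γ} :=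
    hg.isOpen.preimage (by fun_prop)
  have h := hasStrictFDerivAt_leftInvOn hS
    (h := fun q : Vec n × ℝ => (q.1, gStar g Γ q.1 y q.2)) (a := (x, z)) ha hf fun q hq => by
      change (q.1, gStar g Γ q.1 y (g (q.1, y, q.2))) = q
      rw [hg.gStar_eq hq]
  exact ⟨_, hasStrictFDerivAt_snd.comp _ h.1⟩

/-! ### The coordinates Q. -/

/-- This is how Q enters: for a fixed variation (q, r) the sign of the change of g at x is decided
by the side of a hyperplane on which Q(x) lies. -/
theorem IsGeneratingFunction.fderiv_zero_fst (hg : IsGeneratingFunction g Γ) {x y z}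
    (ha : (x, y, z) ∈ Γ) (q : Vec n) (r : ℝ) :
    fderiv ℝ g (x, y, z) (0, q, r) = gz g x y z * (r - inner ℝ (mapQ g x y z) q) := by
  have hz := (hg.gz_neg x y z ha).ne
  rw [hg.fderiv_apply ha, mapQ, inner_neg_left, real_inner_smul_left, inner_zero_right]
  field_simp
  ring

theorem IsGeneratingFunction.contDiffAt_fderiv_apply (hg : IsGeneratingFunction g Γ) {x y z}
    (ha : (x, y, z) ∈ Γ) (v : Vec n × Vec n × ℝ) :
    ContDiffAt ℝ 1 (fun x' => fderiv ℝ g (x', y, z) v) x := by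
  have h1 : ContDiffAt ℝ 1 (fun x' : Vec n => (x', y, z)) x := by fun_prop
  exact ((hg.contDiffAt_fderiv ha).comp x h1).clm_apply contDiffAt_const

theorem IsGeneratingFunction.mapQ_contDiffAt (hg : IsGeneratingFunction g Γ) {x y z}
    (ha : (x, y, z) ∈ Γ) : ContDiffAt ℝ 1 (fun x' => mapQ g x' y z) x := by
  rw [contDiffAt_euclidean]
  intro i
  have h : ContDiffAt ℝ 1 (fun x' => -((fderiv ℝ g (x', y, z) (0, 0, 1))⁻¹ *
      fderiv ℝ g (x', y, z) (0, EuclideanSpace.single i 1, 0))) x :=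
    (((hg.contDiffAt_fderiv_apply ha _).inv (hg.fderiv_z_neg ha).ne).mul (hg.contDiffAt_fderiv_apply ha _)).neg
  refine h.congr_of_eventuallyEq ?_
  filter_upwards [eventually_mem_slice hg.isOpen ha] with x' hx'
  rw [← hg.gz_eq hx', ← hg.inner_gy hx', EuclideanSpace.inner_single_right]
  simp [mapQ]

/-- Differentiate `fderiv_zero_fst` in x: the factor r − ⟨Q, q⟩ vanishes at the point, so only the
derivative of Q survives the product rule, while the other side is a mixed second derivative. -/
theorem IsGeneratingFunction.inner_fderiv_mapQ (hg : IsGeneratingFunction g Γ) {x y z}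
    (ha : (x, y, z) ∈ Γ) {ω : Vec n × ℝ} (hω : fderiv ℝ g (x, y, z) (0, ω) = 0) (h : Vec n) :
    gz g x y z * inner ℝ (fderiv ℝ (fun x' => mapQ g x' y z) x h) ω.1 =
      - inner ℝ (firstGrad n (hess g (x, y, z) (0, ω))) h := by
  obtain ⟨q, r⟩ := ω
  have hz := (hg.gz_neg x y z ha).ne
  have h0 : r - inner ℝ (mapQ g x y z) q = 0 := by
    rw [hg.fderiv_zero_fst ha] at hω
    exact (mul_eq_zero.1 hω).resolve_left hz
  have h1 := ((hg.hasStrictFDerivAt_fderiv ha).hasFDerivAt.comp x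
    (hasFDerivAt_prodMk_left (𝕜 := ℝ) x (y, z))).clm_apply
      (hasFDerivAt_const ((0, q, r) : Vec n × Vec n × ℝ) x)
  have hQ := ((hg.mapQ_contDiffAt ha).differentiableAt (by norm_num)).hasFDerivAt
  have hZ := ((hg.contDiffAt_fderiv_apply ha (0, 0, 1)).differentiableAt (by norm_num)).hasFDerivAt
  have hI : HasFDerivAt (fun x' => r - inner ℝ (mapQ g x' y z) q)
      (-((innerSL ℝ q).comp (fderiv ℝ (fun x' => mapQ g x' y z) x))) x := by
    have := ((innerSL ℝ q).hasFDerivAt.comp x hQ).const_sub r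
    refine this.congr_of_eventuallyEq (Eventually.of_forall fun x' => ?_)
    simp [real_inner_comm]
  have h2 := hZ.mul hI
  have h3 : (fun x' => fderiv ℝ g (x', y, z) (0, q, r)) =ᶠ[𝓝 x]
      ((fun x' => fderiv ℝ g (x', y, z) (0, 0, 1)) * fun x' => r - inner ℝ (mapQ g x' y z) q) := by
    filter_upwards [eventually_mem_slice hg.isOpen ha] with x' hx'
    rw [hg.fderiv_zero_fst hx', Pi.mul_apply, ← hg.gz_eq hx']
  have h4 := congrArg (fun L : Vec n →L[ℝ] ℝ => L h) (h1.unique (h2.congr_of_eventuallyEq h3))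
  simp only [h0] at h4
  rw [inner_firstGrad, hg.hess_symm ha, real_inner_comm]
  rw [← hg.gz_eq ha] at h4
  simp at h4
  change gz g x y z * inner ℝ q _ = -(hess g (x, y, z) (h, 0) (0, q, r))
  linarith

/-- If DQ kills h, pairing with the lift whose gradient variation is h itself gives ‖h‖² = 0. -/
theorem IsGeneratingFunction.exists_mapQ_equiv (hg : IsGeneratingFunction g Γ)
    (hA2 : CondA2 g Γ) {x y z} (ha : (x, y, z) ∈ Γ) : ∃ L : Vec n ≃L[ℝ] Vec n,
      HasStrictFDerivAt (fun x' => mapQ g x' y z) (L : Vec n →L[ℝ] Vec n) x := by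
  have hQ := (hg.mapQ_contDiffAt ha).hasStrictFDerivAt (by norm_num)
  set A := fderiv ℝ (fun x' => mapQ g x' y z) x with hA
  obtain ⟨L, hL⟩ := exists_continuousLinearEquiv_of_injective A (by
    intro h hh
    obtain ⟨ω, h1, h2⟩ := hg.exists_lift hA2 ha h
    have h3 := hg.inner_fderiv_mapQ ha h1 h
    rw [← hA, hh, h2, inner_zero_left, mul_zero, eq_comm, neg_eq_zero] at h3
    exact inner_self_eq_zero.1 h3) rfl
  exact ⟨L, hL ▸ hQ⟩

/-! ### Positivity of tangential variations at nearby points. -/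

theorem IsGeneratingFunction.continuousAt_jetDeriv (hg : IsGeneratingFunction g Γ) {a}
    (ha : a ∈ Γ) : ContinuousAt (jetDeriv g) a := by
  have h1 : ContinuousAt (fderiv ℝ g) a := (hg.contDiffAt_fderiv ha).continuousAt
  have h2 := hg.continuousAt_hess ha
  have h3 : ContinuousAt (fun a => firstGrad n ∘L hess g a) a := by
    exact continuousAt_const.clm_comp h2
  have h4 : jetDeriv g = fun a =>
      (ContinuousLinearMap.inl ℝ (Vec n) (ℝ × Vec n)) ∘L
          (ContinuousLinearMap.fst ℝ (Vec n) (Vec n × ℝ)) +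
        ((ContinuousLinearMap.inr ℝ (Vec n) (ℝ × Vec n)) ∘L
          (ContinuousLinearMap.inl ℝ ℝ (Vec n))) ∘L fderiv ℝ g a +
        ((ContinuousLinearMap.inr ℝ (Vec n) (ℝ × Vec n)) ∘L
          (ContinuousLinearMap.inr ℝ ℝ (Vec n))) ∘L (firstGrad n ∘L hess g a) := by
    funext a
    refine ContinuousLinearMap.ext fun ω => ?_
    simp [jetDeriv_apply]
  rw [h4]
  exact (continuousAt_const.add (continuousAt_const.clm_comp h1)).add
    (continuousAt_const.clm_comp h3)

set_option maxSynthPendingDepth 3 in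
/-- Close to a point of `Γ`, moving from `x'` towards `x` the contact point of a generating function
that is kept tangent along the way increases its value at `x`. -/
theorem IsGeneratingFunction.eventually_fderiv_lift_pos (hg : IsGeneratingFunction g Γ)
    (hA2 : CondA2 g Γ) {x₀ : Vec n} {T₀ : Vec n × ℝ} (h₀ : (x₀, T₀) ∈ Γ) :
    ∀ᶠ p : (Vec n × Vec n) × (Vec n × ℝ) in 𝓝 ((x₀, x₀), T₀),
      (p.1.1, p.2) ∈ Γ ∧ ∀ ω : Vec n × ℝ, fderiv ℝ g (p.1.2, p.2) (0, ω) = 0 →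
        firstGrad n (hess g (p.1.2, p.2) (0, ω)) = p.1.1 - p.1.2 → p.1.1 ≠ p.1.2 →
        0 < fderiv ℝ g (p.1.1, p.2) (0, ω) := by
  obtain ⟨L, hL⟩ := hg.exists_jetEquiv hA2 h₀
  obtain ⟨K, hK, hLK⟩ : ∃ K : ℝ, 0 < K ∧ ∀ ω, ‖ω‖ ≤ K * ‖jetDeriv g (x₀, T₀) ω‖ := by
    refine ⟨‖(L.symm : (Vec n × ℝ × Vec n) →L[ℝ] (Vec n × Vec n × ℝ))‖ + 1, by positivity,
      fun ω => ?_⟩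
    have h1 := (L.symm : (Vec n × ℝ × Vec n) →L[ℝ] (Vec n × Vec n × ℝ)).le_opNorm (L ω)
    have h2 : jetDeriv g (x₀, T₀) ω = L ω := by rw [← hL]; rfl
    simp only [ContinuousLinearEquiv.coe_coe, ContinuousLinearEquiv.symm_apply_apply] at h1
    rw [h2]
    nlinarith [norm_nonneg (L ω)]
  have t1 : Tendsto (fun p : (Vec n × Vec n) × (Vec n × ℝ) => (p.1.1, p.2))
      (𝓝 ((x₀, x₀), T₀)) (𝓝 (x₀, T₀)) := Continuous.tendsto' (by fun_prop) _ _ rfl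
  have t2 : Tendsto (fun p : (Vec n × Vec n) × (Vec n × ℝ) => (p.1.2, p.2))
      (𝓝 ((x₀, x₀), T₀)) (𝓝 (x₀, T₀)) := Continuous.tendsto' (by fun_prop) _ _ rfl
  -- The radius 1/(2K) keeps the bound on the lift, ‖ω‖ ≤ 2K‖k‖, at nearby points. With it, each of
  -- the two errors of size 1/(8K)·‖k‖·‖ω‖ is at most ‖k‖²/4.
  have e1 : ∀ᶠ p : (Vec n × Vec n) × (Vec n × ℝ) in 𝓝 ((x₀, x₀), T₀),
      ‖jetDeriv g (p.1.2, p.2) - jetDeriv g (x₀, T₀)‖ < 1 / (2 * K) := by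
    exact t2.eventually ((tendsto_iff_norm_sub_tendsto_zero.1
      (hg.continuousAt_jetDeriv h₀)).eventually_lt_const (by positivity))
  have e2 : ∀ᶠ p : (Vec n × Vec n) × (Vec n × ℝ) in 𝓝 ((x₀, x₀), T₀),
      ‖hess g (p.1.2, p.2) - hess g (x₀, T₀)‖ < 1 / (8 * K) := by
    exact t2.eventually ((tendsto_iff_norm_sub_tendsto_zero.1
      (hg.continuousAt_hess h₀)).eventually_lt_const (by positivity))
  have e3 := (t1.prodMk_nhds t2).eventually ((hg.hasStrictFDerivAt_fderiv h₀).isLittleO.def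
    (show 0 < 1 / (8 * K) by positivity))
  filter_upwards [e1, e2, e3, t1.eventually (hg.isOpen.mem_nhds h₀),
    t2.eventually (hg.isOpen.mem_nhds h₀)]
  rintro ⟨⟨x, x'⟩, T⟩ h1 h2 h3 h4 h5
  refine ⟨h4, fun ω hω1 hω2 hne => ?_⟩
  dsimp only at *
  set k := x - x' with hk
  have hkpos : 0 < ‖k‖ := norm_pos_iff.2 (sub_ne_zero.2 hne)
  have hsub : ((x, T) : Vec n × Vec n × ℝ) - (x', T) = (k, 0) := by simp [hk]
  have hnk : ‖((k, 0) : Vec n × Vec n × ℝ)‖ = ‖k‖ := by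
    rw [Prod.norm_def]; simp
  have hω : ‖((0, ω) : Vec n × Vec n × ℝ)‖ ≤ 2 * K * ‖k‖ := by
    have i1 := hLK (0, ω)
    have i2 : jetDeriv g (x', T) (0, ω) = (0, 0, k) := by
      rw [jetDeriv_apply, hω1, hω2]
    have i3 : ‖jetDeriv g (x₀, T₀) (0, ω)‖ ≤ ‖k‖ + 1 / (2 * K) * ‖((0, ω) : Vec n × Vec n × ℝ)‖ := by
      have i4 : jetDeriv g (x₀, T₀) (0, ω) =
          (0, 0, k) - (jetDeriv g (x', T) - jetDeriv g (x₀, T₀)) (0, ω) := by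
        rw [← i2, sub_apply]
        abel
      have i5 : ‖((0, 0, k) : Vec n × ℝ × Vec n)‖ = ‖k‖ := by
        simp [Prod.norm_def]
      rw [i4]
      refine (norm_sub_le _ _).trans ?_
      rw [i5]
      gcongr
      exact ((jetDeriv g (x', T) - jetDeriv g (x₀, T₀)).le_opNorm _).trans (by gcongr)
    have i6 : K * (‖k‖ + 1 / (2 * K) * ‖((0, ω) : Vec n × Vec n × ℝ)‖) =
        K * ‖k‖ + ‖((0, ω) : Vec n × Vec n × ℝ)‖ / 2 := by
      field_simp
    have i7 := i1.trans (mul_le_mul_of_nonneg_left i3 hK.le)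
    rw [i6] at i7
    linarith
  have j1 : hess g (x', T) (k, 0) (0, ω) = ‖k‖ ^ 2 := by
    rw [hg.hess_symm h5]
    change hess g (x', T) (0, ω) (k, 0, 0) = _
    rw [← inner_firstGrad, hω2, real_inner_self_eq_norm_sq]
  rw [hsub, hnk] at h3
  -- Expansion from x' to x: the zeroth-order term vanishes by stationarity, the first-order term is
  -- ⟨k, k⟩, and the two errors together take at most half of it.
  have j2 : fderiv ℝ g (x, T) (0, ω) = ‖k‖ ^ 2 +
      (fderiv ℝ g (x, T) - fderiv ℝ g (x', T) - hess g (x₀, T₀) (k, 0)) (0, ω) -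
      (hess g (x', T) - hess g (x₀, T₀)) (k, 0) (0, ω) := by
    simp only [sub_apply]
    rw [hω1, j1]
    ring
  have j3 := (fderiv ℝ g (x, T) - fderiv ℝ g (x', T) - hess g (x₀, T₀) (k, 0)).le_opNorm (0, ω)
  have j4 := (hess g (x', T) - hess g (x₀, T₀)).le_opNorm₂ (k, 0) (0, ω)
  rw [hnk] at j4
  have j5 : 1 / (8 * K) * ‖k‖ * ‖((0, ω) : Vec n × Vec n × ℝ)‖ ≤ ‖k‖ ^ 2 / 4 := by
    have : 1 / (8 * K) * ‖k‖ * (2 * K * ‖k‖) = ‖k‖ ^ 2 / 4 := by field_simp; norm_num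
    rw [← this]
    gcongr
  have j6 : ‖(fderiv ℝ g (x, T) - fderiv ℝ g (x', T) - hess g (x₀, T₀) (k, 0)) (0, ω)‖
      ≤ ‖k‖ ^ 2 / 4 := (j3.trans (by gcongr)).trans j5
  have j7 : ‖(hess g (x', T) - hess g (x₀, T₀)) (k, 0) (0, ω)‖ ≤ ‖k‖ ^ 2 / 4 :=
    (j4.trans (by gcongr)).trans j5
  rw [Real.norm_eq_abs, abs_le] at j6 j7
  rw [j2]
  nlinarith [j6.1, j7.2]

/-! ### Contact levels and g-segments. -/

/-- The level `z` at which `g(·, y₁, z)` meets `g(·, y₀, z₀)` at the point `x`. -/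
def contactLevel (g : Vec n × Vec n × ℝ → ℝ) (Γ : Set (Vec n × Vec n × ℝ)) (y₀ : Vec n) (z₀ : ℝ)
    (y₁ x : Vec n) : ℝ :=
  gStar g Γ x y₁ (g (x, y₀, z₀))

/-- The difference of the gradients at `x` of the two generating functions meeting there. -/
def gradGap (g : Vec n × Vec n × ℝ → ℝ) (Γ : Set (Vec n × Vec n × ℝ)) (y₀ : Vec n) (z₀ : ℝ)
    (y₁ x : Vec n) : Vec n :=
  gx g x y₁ (contactLevel g Γ y₀ z₀ y₁ x) - gx g x y₀ z₀

/-- The `g`-segment joining `(y₀, z₀)` to `(y₁, contactLevel x)` with base point `x`. -/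
def gSegment (g : Vec n × Vec n × ℝ → ℝ) (Γ : Set (Vec n × Vec n × ℝ)) (y₀ : Vec n) (z₀ : ℝ)
    (y₁ x : Vec n) (t : ℝ) : Vec n × ℝ :=
  mapYZ g Γ x (g (x, y₀, z₀)) (gx g x y₀ z₀ + t • gradGap g Γ y₀ z₀ y₁ x)

/-- `(y₀, z₀)` and `y₁` are joined by `g`-segments based at every point of `Ω`. -/
structure IsJoined (g : Vec n × Vec n × ℝ → ℝ) (Γ : Set (Vec n × Vec n × ℝ)) (Ω : Set (Vec n))
    (y₀ : Vec n) (z₀ : ℝ) (y₁ : Vec n) : Prop where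
  gen : IsGeneratingFunction g Γ
  a1 : CondA1 g Γ
  a2 : CondA2 g Γ
  a3w : CondA3w g Γ
  isOpen : IsOpen Ω
  mem_zero : ∀ x ∈ Ω, (x, y₀, z₀) ∈ Γ
  mem_dual : ∀ x ∈ Ω, (x, y₁, g (x, y₀, z₀)) ∈ dualDomain g Γ
  segment_subset : ∀ x ∈ Ω, segment ℝ (gx g x y₀ z₀)
    (gx g x y₁ (contactLevel g Γ y₀ z₀ y₁ x)) ⊆ jetFiber g Γ x (g (x, y₀, z₀))

namespace IsJoined

variable {Ω : Set (Vec n)} {y₀ y₁ : Vec n} {z₀ : ℝ} 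
  {x : Vec n} {t : ℝ}

local notation "lev" => contactLevel g Γ y₀ z₀ y₁
local notation "gap" => gradGap g Γ y₀ z₀ y₁
local notation "seg" => gSegment g Γ y₀ z₀ y₁

theorem level_spec (hJ : IsJoined g Γ Ω y₀ z₀ y₁) (hx : x ∈ Ω) : (x, y₁, lev x) ∈ Γ ∧ g (x, y₁, lev x) = g (x, y₀, z₀) :=
  gStar_spec (hJ.mem_dual x hx)

theorem jet_mem (hJ : IsJoined g Γ Ω y₀ z₀ y₁) (hx : x ∈ Ω) (ht : t ∈ Icc (0 : ℝ) 1) :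
    (x, g (x, y₀, z₀), gx g x y₀ z₀ + t • gap x) ∈ jetSet g Γ := by
  refine hJ.segment_subset x hx ?_
  rw [segment_eq_image']
  exact ⟨t, ht, rfl⟩

theorem gSegment_spec (hJ : IsJoined g Γ Ω y₀ z₀ y₁) (hx : x ∈ Ω) (ht : t ∈ Icc (0 : ℝ) 1) :
    (x, seg x t) ∈ Γ ∧ g (x, seg x t) = g (x, y₀, z₀) ∧
      gxFun g (x, seg x t) = gx g x y₀ z₀ + t • gap x :=
  mapYZ_spec (hJ.jet_mem hx ht)

theorem gSegment_zero (hJ : IsJoined g Γ Ω y₀ z₀ y₁) (hx : x ∈ Ω) : seg x 0 = (y₀, z₀) := by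
  rw [gSegment, zero_smul, add_zero]
  exact hJ.a1.mapYZ_eq (hJ.mem_zero x hx)

theorem gSegment_one (hJ : IsJoined g Γ Ω y₀ z₀ y₁) (hx : x ∈ Ω) : seg x 1 = (y₁, lev x) := by
  rw [gSegment, one_smul, gradGap, add_sub_cancel, ← (hJ.level_spec hx).2]
  exact hJ.a1.mapYZ_eq (hJ.level_spec hx).1

/-- With zero gap the g-segment would be constant, but its ends have different y-components. -/
theorem gradGap_ne_zero (hJ : IsJoined g Γ Ω y₀ z₀ y₁) (hx : x ∈ Ω) (hy : y₁ ≠ y₀) :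
    gap x ≠ 0 := by
  intro h
  have h0 := hJ.gSegment_zero hx
  have h1 := hJ.gSegment_one hx
  rw [gSegment, h, smul_zero] at h0 h1
  exact hy (congrArg Prod.fst (h1.symm.trans h0))

theorem hasStrictFDerivAt_zero (hJ : IsJoined g Γ Ω y₀ z₀ y₁) (hx : x ∈ Ω) :
    HasStrictFDerivAt (fun x => g (x, y₀, z₀))
      ((fderiv ℝ g (x, y₀, z₀)).comp (ContinuousLinearMap.inl ℝ (Vec n) (Vec n × ℝ))) x :=
  (hJ.gen.hasStrictFDerivAt (hJ.mem_zero x hx)).comp x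
    ((hasStrictFDerivAt_id (𝕜 := ℝ) x).prodMk (hasStrictFDerivAt_const (y₀, z₀) x))

theorem hasStrictFDerivAt_gx_zero (hJ : IsJoined g Γ Ω y₀ z₀ y₁) (hx : x ∈ Ω) :
    HasStrictFDerivAt (fun x => gx g x y₀ z₀) ((firstGrad n ∘L hess g (x, y₀, z₀)).comp
      (ContinuousLinearMap.inl ℝ (Vec n) (Vec n × ℝ))) x := by
  have h := (hJ.gen.hasStrictFDerivAt_gx (hJ.mem_zero x hx)).comp x
    ((hasStrictFDerivAt_id (𝕜 := ℝ) x).prodMk (hasStrictFDerivAt_const (y₀, z₀) x))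
  exact h

/-- Differentiate g(x, y₁, lev x) = g₀(x). As g_z < 0, the gradient of lev is a positive multiple of
the gap, so moving along the gap raises lev and moving orthogonally fixes it to first order. -/
theorem exists_hasStrictFDerivAt_level (hJ : IsJoined g Γ Ω y₀ z₀ y₁) (hx : x ∈ Ω) :
    ∃ L : Vec n →L[ℝ] ℝ, HasStrictFDerivAt lev L x ∧
      ∀ h, gz g x y₁ (lev x) * L h = - inner ℝ (gap x) h := by
  obtain ⟨L, hL⟩ := hJ.gen.gStar_regular (hJ.mem_dual x hx)
  have h1 := HasStrictFDerivAt.comp (g := fun q : Vec n × ℝ => gStar g Γ q.1 y₁ q.2) x hL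
    ((hasStrictFDerivAt_id (𝕜 := ℝ) x).prodMk (hJ.hasStrictFDerivAt_zero hx))
  replace h1 : HasStrictFDerivAt lev _ x := h1
  refine ⟨_, h1, fun h => ?_⟩
  set L' := L.comp ((ContinuousLinearMap.id ℝ (Vec n)).prod ((fderiv ℝ g (x, y₀, z₀)).comp
    (ContinuousLinearMap.inl ℝ (Vec n) (Vec n × ℝ))))
  have h2 := ((hJ.gen.hasStrictFDerivAt (hJ.level_spec hx).1).comp x
    ((hasStrictFDerivAt_id (𝕜 := ℝ) x).prodMk ((hasStrictFDerivAt_const y₁ x).prodMk h1))).hasFDerivAt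
  have h3 := h2.unique ((hJ.hasStrictFDerivAt_zero hx).hasFDerivAt.congr_of_eventuallyEq (by
    filter_upwards [hJ.isOpen.mem_nhds hx] with x' hx'
    exact (hJ.level_spec hx').2))
  have h4 := congrArg (fun A : Vec n →L[ℝ] ℝ => A h) h3
  change fderiv ℝ g (x, y₁, lev x) (h, 0, L' h) = fderiv ℝ g (x, y₀, z₀) (h, 0, 0) at h4
  rw [hJ.gen.fderiv_apply (hJ.level_spec hx).1, hJ.gen.fderiv_apply (hJ.mem_zero x hx)] at h4
  simp only [inner_zero_right, mul_zero, add_zero] at h4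
  rw [gradGap, inner_sub_left]
  linarith

/-- The derivative of the `g`-segment map in the base point and in the parameter. -/
theorem exists_hasStrictFDerivAt_gSegment (hJ : IsJoined g Γ Ω y₀ z₀ y₁) (hx : x ∈ Ω)
    (ht : t ∈ Icc (0 : ℝ) 1) :
    ∃ L : (Vec n × ℝ) →L[ℝ] (Vec n × ℝ),
      HasStrictFDerivAt (fun q : Vec n × ℝ => seg q.1 q.2) L (x, t) ∧
      (fderiv ℝ g (x, seg x t) (0, L (0, 1)) = 0 ∧
        firstGrad n (hess g (x, seg x t) (0, L (0, 1))) = gap x) ∧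
      ∀ ζ, inner ℝ (gap x) ζ = 0 → fderiv ℝ g (x, seg x t) (0, L (ζ, 0)) = 0 ∧
        0 ≤ inner ℝ (firstGrad n (hess g (x, seg x t) (0, L (ζ, 0)))) ζ := by
  obtain ⟨Lv, hLv, hLv'⟩ := hJ.exists_hasStrictFDerivAt_level hx
  obtain ⟨⟨M, hM⟩, hnhds⟩ := hJ.gen.mapYZ_regular hJ.a1 hJ.a2 (hJ.jet_mem hx ht)
  obtain ⟨hs1, hs2, hs3⟩ := hJ.gSegment_spec hx ht
  have hl := (hJ.level_spec hx).1
  have h0 := hJ.mem_zero x hx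
  have d1 := (hJ.gen.hasStrictFDerivAt_gx hl).comp x
    ((hasStrictFDerivAt_id (𝕜 := ℝ) x).prodMk ((hasStrictFDerivAt_const y₁ x).prodMk hLv))
  have dgap := d1.sub (hJ.hasStrictFDerivAt_gx_zero hx)
  replace dgap : HasStrictFDerivAt gap _ x := dgap
  set D₁ := (firstGrad n ∘L hess g (x, y₁, lev x)).comp
    ((ContinuousLinearMap.id ℝ (Vec n)).prod ((0 : Vec n →L[ℝ] Vec n).prod Lv))
  have fst' : HasStrictFDerivAt (fun q : Vec n × ℝ => q.1)
      (ContinuousLinearMap.fst ℝ (Vec n) ℝ) (x, t) := hasStrictFDerivAt_fst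
  have dp : HasStrictFDerivAt (fun q : Vec n × ℝ => gx g q.1 y₀ z₀ + q.2 • gap q.1) _ (x, t) :=
    ((hJ.hasStrictFDerivAt_gx_zero hx).comp (x, t) fst').add
      (hasStrictFDerivAt_snd.smul (dgap.comp (x, t) fst'))
  have du := (hJ.hasStrictFDerivAt_zero hx).comp (x, t) fst'
  have dj : HasStrictFDerivAt
      (fun q : Vec n × ℝ => (q.1, g (q.1, y₀, z₀), gx g q.1 y₀ z₀ + q.2 • gap q.1)) _ (x, t) :=
    fst'.prodMk (du.prodMk dp)
  obtain ⟨L, dseg⟩ : ∃ L : (Vec n × ℝ) →L[ℝ] (Vec n × ℝ),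
      HasStrictFDerivAt (fun q : Vec n × ℝ => seg q.1 q.2) L (x, t) :=
    ⟨_, HasStrictFDerivAt.comp (g := fun q : Vec n × ℝ × Vec n => mapYZ g Γ q.1 q.2.1 q.2.2)
      (x, t) hM dj⟩
  refine ⟨L, dseg, ?_⟩
  have hev := dj.continuousAt.eventually_mem hnhds
  have dpair : HasStrictFDerivAt (fun q : Vec n × ℝ => (q.1, seg q.1 q.2)) _ (x, t) :=
    fst'.prodMk dseg
  have k1 := ((hJ.gen.hasStrictFDerivAt hs1).comp (x, t) dpair).hasFDerivAt.unique
    (du.hasFDerivAt.congr_of_eventuallyEq (by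
      filter_upwards [hev] with q hq using (mapYZ_spec hq).2.1))
  have k2 := ((hJ.gen.hasStrictFDerivAt_gx hs1).comp (x, t) dpair).hasFDerivAt.unique
    (dp.hasFDerivAt.congr_of_eventuallyEq (by
      filter_upwards [hev] with q hq using (mapYZ_spec hq).2.2))
  have k1' : ∀ ζ τ, fderiv ℝ g (x, seg x t) (ζ, L (ζ, τ)) = fderiv ℝ g (x, y₀, z₀) (ζ, 0, 0) :=
    fun ζ τ => congrArg (fun A : (Vec n × ℝ) →L[ℝ] ℝ => A (ζ, τ)) k1
  have k2' : ∀ ζ τ, firstGrad n (hess g (x, seg x t) (ζ, L (ζ, τ))) =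
      firstGrad n (hess g (x, y₀, z₀) (ζ, 0, 0)) + (t • (firstGrad n (hess g (x, y₁, lev x) (ζ, 0, Lv ζ)) -
        firstGrad n (hess g (x, y₀, z₀) (ζ, 0, 0))) + τ • gap x) :=
    fun ζ τ => congrArg (fun A : (Vec n × ℝ) →L[ℝ] Vec n => A (ζ, τ)) k2
  have hsplit : ∀ (ζ : Vec n) (ω : Vec n × ℝ),
      ((ζ, ω) : Vec n × Vec n × ℝ) = (ζ, 0, 0) + (0, ω) := fun ζ ω => by simp
  refine ⟨⟨?_, ?_⟩, fun ζ hζ => ?_⟩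
  · rw [k1' 0 1]
    exact map_zero _
  · have z1 : ((0, 0, Lv 0) : Vec n × Vec n × ℝ) = 0 := by rw [map_zero]; rfl
    have z2 : ((0, 0, 0) : Vec n × Vec n × ℝ) = 0 := rfl
    rw [k2' 0 1, z1, z2]
    simp
  -- Orthogonality to the gap freezes the far end (y₁, lev) to first order, so the end gradients
  -- vary only through g_xx.
  have hLv0 : Lv ζ = 0 := by
    have := hLv' ζ
    rw [hζ, neg_zero] at this
    exact (mul_eq_zero.1 this).resolve_left (hJ.gen.gz_neg _ _ _ hl).ne
  have q1 := k1' ζ 0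
  have q2 := k2' ζ 0
  rw [hsplit ζ, map_add] at q1 q2
  rw [map_add] at q2
  have r0 : fderiv ℝ g (x, seg x t) (ζ, 0, 0) = fderiv ℝ g (x, y₀, z₀) (ζ, 0, 0) := by
    have e1 : inner ℝ (gxFun g (x, seg x t)) ζ = fderiv ℝ g (x, seg x t) (ζ, 0, 0) :=
      hJ.gen.inner_gx (y := (seg x t).1) (z := (seg x t).2) hs1 ζ
    rw [← hJ.gen.inner_gx h0, ← e1, hs3, inner_add_left, real_inner_smul_left, hζ, mul_zero, add_zero]
  refine ⟨by linarith, ?_⟩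
  rw [← eq_sub_iff_add_eq'] at q2
  rw [q2, hLv0, zero_smul, add_zero, inner_sub_left, inner_add_left, real_inner_smul_left,
    inner_sub_left, inner_firstGrad, inner_firstGrad, inner_firstGrad, ← hJ.gen.gxxForm_eq h0,
    ← hJ.gen.gxxForm_eq hl]
  have et : gxxForm g x (seg x t).1 (seg x t).2 ζ = hess g (x, seg x t) (ζ, 0, 0) (ζ, 0, 0) :=
    hJ.gen.gxxForm_eq (y := (seg x t).1) (z := (seg x t).2) hs1 ζ
  rw [← et]
  have hζ' : inner ℝ ζ (gx g x y₁ (lev x) - gx g x y₀ z₀) = 0 := by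
    rw [real_inner_comm]; exact hζ
  -- The gradient variation paired with ζ equals (1 − t)A₀ + tA₁ − A_t, the forms A being taken at ζ
  -- on the gradient segment; A3w says that it is nonnegative.
  have hconv := (hJ.a3w x _ ζ _ _ (hJ.segment_subset x hx) hζ').2 (left_mem_segment ℝ _ _)
    (right_mem_segment ℝ _ _) (sub_nonneg.2 ht.2) ht.1 (sub_add_cancel 1 t)
  have c0 : mapYZ g Γ x (g (x, y₀, z₀)) (gx g x y₀ z₀) = (y₀, z₀) :=
    hJ.a1.mapYZ_eq (a := (x, y₀, z₀)) h0
  have c1 : mapYZ g Γ x (g (x, y₀, z₀)) (gx g x y₁ (lev x)) = (y₁, lev x) := by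
    rw [← (hJ.level_spec hx).2]
    exact hJ.a1.mapYZ_eq (a := (x, y₁, lev x)) hl
  have ct : (1 - t) • gx g x y₀ z₀ + t • gx g x y₁ (lev x) = gx g x y₀ z₀ + t • gap x := by
    rw [gradGap]
    module
  rw [ct] at hconv
  simp only [formA, c0, c1, smul_eq_mul] at hconv
  change gxxForm g x (seg x t).1 (seg x t).2 ζ ≤ _ at hconv
  linarith

end IsJoined

/-! ### The local maximum principle. -/

theorem eventually_lt_of_hasDerivAt_pos {f : ℝ → ℝ} {f' a : ℝ} (hf : HasDerivAt f f' a)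
    (hf' : 0 < f') : ∀ᶠ s in 𝓝[>] a, f a < f s := by
  have h := (hasDerivAt_iff_tendsto_slope.1 hf).eventually (lt_mem_nhds hf')
  filter_upwards [h.filter_mono (nhdsWithin_mono a fun s (hs : a < s) => hs.ne'),
    self_mem_nhdsWithin] with s hs hs'
  rw [slope_def_field, div_pos_iff_of_pos_right (sub_pos.2 hs')] at hs
  exact sub_pos.1 hs

theorem hasDerivAt_line (x ζ : Vec n) : HasDerivAt (fun s : ℝ => x + s • ζ) ζ 0 := by
  simpa using ((hasDerivAt_id (0 : ℝ)).smul_const ζ).const_add x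

theorem hasDerivAt_norm_sq_line (x x' ζ : Vec n) :
    HasDerivAt (fun s : ℝ => ‖x' + s • ζ - x‖ ^ 2) (-(2 * inner ℝ (x - x') ζ)) 0 := by
  have h := ((hasDerivAt_line x' ζ).sub_const x).norm_sq
  convert h using 1
  rw [zero_smul, add_zero, ← neg_sub x, inner_neg_left]
  ring

namespace IsJoined

variable {Ω : Set (Vec n)} {y₀ y₁ : Vec n} {z₀ : ℝ} {x x' : Vec n} {t : ℝ}

local notation "lev" => contactLevel g Γ y₀ z₀ y₁
local notation "gap" => gradGap g Γ y₀ z₀ y₁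
local notation "seg" => gSegment g Γ y₀ z₀ y₁

/-- At a base point `x'` where the value at `x` of the `g`-segment is stationary in the parameter,
some direction inside the superlevel set of the contact level moves `x'` towards `x` and increases
the penalised value. -/
theorem exists_ascent (hJ : IsJoined g Γ Ω y₀ z₀ y₁) (hx' : x' ∈ Ω) (ht : t ∈ Icc (0 : ℝ) 1)
    (hgap : gap x' ≠ 0) (hxT : (x, seg x' t) ∈ Γ)
    (hpos : ∀ ω : Vec n × ℝ, fderiv ℝ g (x', seg x' t) (0, ω) = 0 →
      firstGrad n (hess g (x', seg x' t) (0, ω)) = x - x' →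
      0 < fderiv ℝ g (x, seg x' t) (0, ω))
    (hmax : IsLocalMax (fun τ => g (x, seg x' τ)) t) {κ : ℝ} (hκ : 0 < κ) :
    ∃ ζ, 0 < inner ℝ (x - x') ζ ∧ 0 < inner ℝ (gap x') ζ ∧ ∀ᶠ s in 𝓝[>] (0 : ℝ),
      g (x, seg x' t) - κ * ‖x' - x‖ ^ 2 <
        g (x, seg (x' + s • ζ) t) - κ * ‖x' + s • ζ - x‖ ^ 2 := by
  obtain ⟨L, hL, ⟨hLt1, hLt2⟩, hLζ⟩ := hJ.exists_hasStrictFDerivAt_gSegment hx' ht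
  obtain ⟨e, he⟩ := hJ.gen.exists_jetEquiv hJ.a2 (hJ.gSegment_spec hx' ht).1
  -- For variations of (y, z) that keep g stationary at x', the first-order change of g at x depends
  -- only on the gradient variation k at x'. `ℓ` is this dependence and `w` represents it.
  set ℓ : Vec n →L[ℝ] ℝ := (fderiv ℝ g (x, seg x' t)).comp
    ((ContinuousLinearMap.inr ℝ (Vec n) (Vec n × ℝ)).comp
      ((ContinuousLinearMap.snd ℝ (Vec n) (Vec n × ℝ)).comp
        ((e.symm : (Vec n × ℝ × Vec n) →L[ℝ] (Vec n × Vec n × ℝ)).comp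
          ((ContinuousLinearMap.inr ℝ (Vec n) (ℝ × Vec n)).comp
            (ContinuousLinearMap.inr ℝ ℝ (Vec n)))))) with hℓ
  have hℓω : ∀ ω : Vec n × ℝ, fderiv ℝ g (x', seg x' t) (0, ω) = 0 →
      fderiv ℝ g (x, seg x' t) (0, ω) = ℓ (firstGrad n (hess g (x', seg x' t) (0, ω))) := by
    intro ω hω
    have h1 : e (0, ω) = (0, 0, firstGrad n (hess g (x', seg x' t) (0, ω))) := by
      have : e (0, ω) = jetDeriv g (x', seg x' t) (0, ω) := by rw [← he]; rfl
      rw [this, jetDeriv_apply, hω]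
    have h2 : e.symm (0, 0, firstGrad n (hess g (x', seg x' t) (0, ω))) = (0, ω) := by
      rw [← h1, e.symm_apply_apply]
    change _ = fderiv ℝ g (x, seg x' t)
      (0, (e.symm (0, 0, firstGrad n (hess g (x', seg x' t) (0, ω)))).2)
    rw [h2]
  obtain ⟨w, hw⟩ : ∃ w : Vec n, ∀ k, ℓ k = inner ℝ w k :=
    ⟨(InnerProductSpace.toDual ℝ (Vec n)).symm ℓ, fun k => by
      rw [InnerProductSpace.toDual_symm_apply]⟩
  have hwk : 0 < inner ℝ (x - x') w := by
    obtain ⟨ω, h1, h2⟩ := hJ.gen.exists_lift hJ.a2 (hJ.gSegment_spec hx' ht).1 (x - x')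
    have := hpos ω h1 h2
    rwa [hℓω ω h1, h2, hw, real_inner_comm] at this
  have dF : HasFDerivAt (fun q : Vec n × ℝ => g (x, seg q.1 q.2)) _ (x', t) :=
    (hJ.gen.hasStrictFDerivAt hxT).hasFDerivAt.comp (x', t)
      ((hasFDerivAt_const x (x', t)).prodMk hL.hasFDerivAt)
  set F := (fderiv ℝ g (x, seg x' t)).comp ((0 : (Vec n × ℝ) →L[ℝ] Vec n).prod L) with hF
  have hFapp : ∀ q, F q = fderiv ℝ g (x, seg x' t) (0, L q) := fun q => rfl
  -- Moving t has gradient variation `gap x'`, so stationarity in t means that `w` is orthogonal to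
  -- the gap, which is the orthogonality A3w needs.
  have hwgap : inner ℝ (gap x') w = 0 := by
    have d1 : HasDerivAt (fun τ : ℝ => (x', τ)) ((0 : Vec n), (1 : ℝ)) t :=
      (hasDerivAt_const t x').prodMk (hasDerivAt_id t)
    have d2 := dF.comp_hasDerivAt t d1
    have := hmax.hasDerivAt_eq_zero d2
    rwa [hFapp, hℓω _ hLt1, hLt2, hw, real_inner_comm] at this
  -- Moving the base point along `w` changes the value at x by ⟨w, k⟩, with k the resulting gradient
  -- variation; A3w makes this nonnegative.
  have hFw : 0 ≤ F (w, 0) := by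
    obtain ⟨h1, h2⟩ := hLζ w hwgap
    rwa [hFapp, hℓω _ h1, hw, real_inner_comm]
  -- At δ = 0 the penalty alone makes the total derivative positive. A small δ > 0 preserves this
  -- and adds a positive component along the gap, so that lev increases strictly.
  obtain ⟨δ, hδ, hδ1, hδ2⟩ : ∃ δ : ℝ, 0 < δ ∧ 0 < inner ℝ (x - x') (w + δ • gap x') ∧
      0 < F (w, 0) + δ * F (gap x', 0) + κ * (2 * inner ℝ (x - x') (w + δ • gap x')) := by
    have c1 : ContinuousAt (fun δ : ℝ => inner ℝ (x - x') (w + δ • gap x')) 0 := by fun_prop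
    have c2 : ContinuousAt (fun δ : ℝ => F (w, 0) + δ * F (gap x', 0) +
      κ * (2 * inner ℝ (x - x') (w + δ • gap x'))) 0 := by fun_prop
    have e1 := c1.eventually (lt_mem_nhds (a := 0) (by simpa using hwk))
    have e2 := c2.eventually (lt_mem_nhds (a := 0) (by
      simp only [zero_mul, zero_smul, add_zero]
      positivity))
    have e3 : ∀ᶠ δ : ℝ in 𝓝[>] 0, 0 < δ := self_mem_nhdsWithin
    obtain ⟨δ, h1, h2, h3⟩ := ((e1.filter_mono nhdsWithin_le_nhds).and
      ((e2.filter_mono nhdsWithin_le_nhds).and e3)).exists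
    exact ⟨δ, h3, h1, h2⟩
  refine ⟨w + δ • gap x', hδ1, ?_, ?_⟩
  · rw [inner_add_right, hwgap, zero_add, real_inner_smul_right]
    exact mul_pos hδ (real_inner_self_pos.2 hgap)
  have d1 : HasDerivAt (fun s : ℝ => (x' + s • (w + δ • gap x'), t)) (w + δ • gap x', (0 : ℝ)) 0 :=
    (hasDerivAt_line x' _).prodMk (hasDerivAt_const 0 t)
  have dF0 : HasFDerivAt (fun q : Vec n × ℝ => g (x, seg q.1 q.2)) F
      (x' + (0 : ℝ) • (w + δ • gap x'), t) := by
    rw [zero_smul, add_zero]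
    exact dF
  have d2 := (dF0.comp_hasDerivAt (0 : ℝ) d1).sub
    ((hasDerivAt_norm_sq_line x x' (w + δ • gap x')).const_mul κ)
  have h3 := eventually_lt_of_hasDerivAt_pos d2 (by
    have : ((w + δ • gap x', 0) : Vec n × ℝ) = (w, 0) + δ • (gap x', 0) := by simp
    rw [this, map_add, map_smul, smul_eq_mul]
    linarith)
  filter_upwards [h3] with s hs
  simpa using hs

theorem continuousOn_level (hJ : IsJoined g Γ Ω y₀ z₀ y₁) : ContinuousOn lev Ω := fun _ hx => by
  obtain ⟨_, h, _⟩ := hJ.exists_hasStrictFDerivAt_level hx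
  exact h.continuousAt.continuousWithinAt

/-- Local version of Loeper's maximum principle. -/
theorem eventually_gSegment_le (hJ : IsJoined g Γ Ω y₀ z₀ y₁) (hy : y₁ ≠ y₀) {a : Vec n}
    (ha : a ∈ Ω) : ∀ᶠ x in 𝓝 a, lev x ≤ lev a → ∀ t ∈ Icc (0 : ℝ) 1,
      (x, seg a t) ∈ Γ ∧ g (x, seg a t) ≤ g (x, y₀, z₀) := by
  -- Compactness of [0, 1] gives one neighbourhood valid for all t.
  have hloc : ∀ᶠ q : Vec n × Vec n in 𝓝 (a, a), ∀ t ∈ Icc (0 : ℝ) 1,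
      (q.1, seg q.2 t) ∈ Γ ∧ ∀ ω : Vec n × ℝ, fderiv ℝ g (q.2, seg q.2 t) (0, ω) = 0 →
        firstGrad n (hess g (q.2, seg q.2 t) (0, ω)) = q.1 - q.2 → q.1 ≠ q.2 →
        0 < fderiv ℝ g (q.1, seg q.2 t) (0, ω) := by
    refine isCompact_Icc.eventually_forall_of_forall_eventually fun t ht => ?_
    obtain ⟨_, hL, _⟩ := hJ.exists_hasStrictFDerivAt_gSegment ha ht
    have hc : Tendsto (fun r : (Vec n × Vec n) × ℝ => (r.1, seg r.1.2 r.2)) (𝓝 ((a, a), t))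
        (𝓝 ((a, a), seg a t)) := by
      refine Tendsto.prodMk_nhds (continuous_fst.tendsto' _ _ rfl) ?_
      have c1 : ContinuousAt (fun r : (Vec n × Vec n) × ℝ => (r.1.2, r.2)) ((a, a), t) := by
        fun_prop
      exact ContinuousAt.comp (g := fun q : Vec n × ℝ => seg q.1 q.2)
        (f := fun r : (Vec n × Vec n) × ℝ => (r.1.2, r.2)) hL.continuousAt c1
    exact hc.eventually (hJ.gen.eventually_fderiv_lift_pos hJ.a2 (hJ.gSegment_spec ha ht).1)
  obtain ⟨r, hr, hball⟩ := Metric.eventually_nhds_iff_ball.1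
    (hloc.and ((continuous_fst.tendsto' (a, a) a rfl).eventually (hJ.isOpen.mem_nhds ha)))
  have hmem : ∀ x ∈ Metric.ball a r, ∀ x' ∈ Metric.ball a r, (x, x') ∈ Metric.ball (a, a) r := by
    intro x hx x' hx'
    rw [← ball_prod_same]
    exact ⟨hx, hx'⟩
  filter_upwards [Metric.ball_mem_nhds a (half_pos hr)] with x hx hlev
  have hxr : x ∈ Metric.ball a r := Metric.ball_subset_ball (by linarith) hx
  have har : a ∈ Metric.ball a r := Metric.mem_ball_self hr
  have hsub : Metric.closedBall x ‖a - x‖ ⊆ Metric.ball a r := by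
    intro x' hx'
    rw [Metric.mem_closedBall] at hx'
    rw [Metric.mem_ball, dist_eq_norm] at hx ⊢
    rw [dist_eq_norm, norm_sub_rev a x] at hx'
    have := norm_sub_le_norm_sub_add_norm_sub x' x a
    linarith
  have hΩ : ∀ x' ∈ Metric.ball a r, x' ∈ Ω := fun x' hx' => (hball _ (hmem x' hx' a har)).2
  -- The ball keeps base points where positivity holds and is not left when moving towards x; the
  -- condition on lev controls the end t = 1.
  set K := {x' | x' ∈ Metric.closedBall x ‖a - x‖ ∧ lev x ≤ lev x'} with hK
  have hKcomp : IsCompact K := by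
    refine (isCompact_closedBall x ‖a - x‖).of_isClosed_subset ?_ fun x' hx' => hx'.1
    exact ((hJ.continuousOn_level.mono fun x' hx' => hΩ x' (hsub hx')).preimage_isClosed_of_isClosed
      Metric.isClosed_closedBall isClosed_Ici)
  have hKball : ∀ x' ∈ K, x' ∈ Metric.ball a r := fun x' hx' => hsub hx'.1
  have haK : a ∈ K := ⟨by rw [Metric.mem_closedBall, dist_eq_norm], hlev⟩
  intro t ht
  have hΓ : ∀ x' ∈ K, ∀ t ∈ Icc (0 : ℝ) 1, (x, seg x' t) ∈ Γ := fun x' hx' t ht =>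
    ((hball _ (hmem x hxr x' (hKball x' hx'))).1 t ht).1
  refine ⟨hΓ a haK t ht, ?_⟩
  -- The penalty is needed because A3w gives only a weak inequality along `w`.
  have key : ∀ κ > 0, g (x, seg a t) - κ * ‖a - x‖ ^ 2 ≤ g (x, y₀, z₀) := by
    intro κ hκ
    have hcont : ContinuousOn (fun q : Vec n × ℝ => g (x, seg q.1 q.2) - κ * ‖q.1 - x‖ ^ 2)
        (K ×ˢ Icc (0 : ℝ) 1) := by
      rintro ⟨x', τ⟩ ⟨hx', hτ⟩
      obtain ⟨_, hL, _⟩ := hJ.exists_hasStrictFDerivAt_gSegment (hΩ x' (hKball x' hx')) hτ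
      have c1 : ContinuousAt (fun q : Vec n × ℝ => g (x, seg q.1 q.2)) (x', τ) :=
        ContinuousAt.comp (g := g) (f := fun q : Vec n × ℝ => (x, seg q.1 q.2))
          (hJ.gen.hasStrictFDerivAt (hΓ x' hx' τ hτ)).continuousAt
          (continuousAt_const.prodMk hL.continuousAt)
      exact (c1.sub (by fun_prop)).continuousWithinAt
    obtain ⟨⟨b, τ⟩, ⟨hbK, hτ⟩, hmax⟩ := (hKcomp.prod isCompact_Icc).exists_isMaxOn
      ⟨(a, t), haK, ht⟩ hcont
    have hmax' : ∀ x' ∈ K, ∀ s ∈ Icc (0 : ℝ) 1, g (x, seg x' s) - κ * ‖x' - x‖ ^ 2 ≤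
        g (x, seg b τ) - κ * ‖b - x‖ ^ 2 := fun x' hx' s hs => hmax (mk_mem_prod hx' hs)
    refine (hmax' a haK t ht).trans ?_
    by_contra! hcon
    have hbΩ := hΩ b (hKball b hbK)
    have hnn : 0 ≤ κ * ‖b - x‖ ^ 2 := by positivity
    -- A maximum above g₀(x) is impossible at t = 0, where the g-segment is at g₀; at t = 1, since
    -- lev b ≥ lev x and g decreases in z; and at b = x, where every member takes the value g₀(x).
    have hne0 : τ ≠ 0 := by
      rintro rfl
      rw [hJ.gSegment_zero hbΩ] at hcon
      linarith
    have hne1 : τ ≠ 1 := by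
      rintro rfl
      have hb1 := hΓ b hbK 1 hτ
      rw [hJ.gSegment_one hbΩ] at hcon hb1
      have hxl := hJ.level_spec (hΩ x hxr)
      have := (hJ.gen.strictAntiOn x y₁).antitoneOn hxl.1 hb1 hbK.2
      simp only [hxl.2] at this
      linarith
    have hnex : x ≠ b := by
      rintro rfl
      rw [(hJ.gSegment_spec hbΩ hτ).2.1] at hcon
      linarith
    have hpos := ((hball _ (hmem x hxr b (hKball b hbK))).1 τ hτ).2
    have hlmax : IsLocalMax (fun s => g (x, seg b s)) τ := by
      filter_upwards [Icc_mem_nhds (hτ.1.lt_of_ne' hne0) (hτ.2.lt_of_ne hne1)] with s hs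
      linarith [hmax' b hbK s hs]
    obtain ⟨ζ, hζ1, hζ2, hζ3⟩ := hJ.exists_ascent hbΩ hτ (hJ.gradGap_ne_zero hbΩ hy)
      (hΓ b hbK τ hτ) (fun ω h1 h2 => hpos ω h1 h2 hnex) hlmax hκ
    have hnorm : ∀ᶠ s in 𝓝[>] (0 : ℝ), ‖b + s • ζ - x‖ ^ 2 < ‖b - x‖ ^ 2 := by
      have := eventually_lt_of_hasDerivAt_pos (hasDerivAt_norm_sq_line x b ζ).neg (by linarith)
      filter_upwards [this] with s hs
      simpa using hs
    have hlevel : ∀ᶠ s in 𝓝[>] (0 : ℝ), lev b < lev (b + s • ζ) := by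
      obtain ⟨Lv, hLv, hLv'⟩ := hJ.exists_hasStrictFDerivAt_level hbΩ
      have hz := hJ.gen.gz_neg _ _ _ (hJ.level_spec hbΩ).1
      have hd : HasFDerivAt lev Lv (b + (0 : ℝ) • ζ) := by
        rw [zero_smul, add_zero]
        exact hLv.hasFDerivAt
      have := eventually_lt_of_hasDerivAt_pos (hd.comp_hasDerivAt (0 : ℝ) (hasDerivAt_line b ζ))
        (by nlinarith [hLv' ζ])
      filter_upwards [this] with s hs
      simpa using hs
    obtain ⟨s, hs1, hs2, hs3⟩ := (hζ3.and (hnorm.and hlevel)).exists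
    refine (hmax' (b + s • ζ) ⟨?_, hbK.2.trans hs3.le⟩ τ hτ).not_gt hs1
    rw [Metric.mem_closedBall, dist_eq_norm]
    have h1 := hbK.1
    rw [Metric.mem_closedBall, dist_eq_norm] at h1
    exact (lt_of_pow_lt_pow_left₀ 2 (norm_nonneg _) hs2).le.trans h1
  refine le_of_forall_pos_le_add fun ε hε => ?_
  have h1 := key (ε / (‖a - x‖ ^ 2 + 1)) (by positivity)
  have h2 : ε / (‖a - x‖ ^ 2 + 1) * ‖a - x‖ ^ 2 ≤ ε := by
    rw [div_mul_eq_mul_div, div_le_iff₀ (by positivity)]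
    nlinarith
  linarith

/-! ### Supporting hyperplanes and quasiconvexity of the contact level. -/

/-- The sublevel sets of the contact level are locally supported by hyperplanes in the coordinates
`mapQ · y₀ z₀`. -/
theorem exists_local_support (hJ : IsJoined g Γ Ω y₀ z₀ y₁) (hy : y₁ ≠ y₀) {a : Vec n}
    (ha : a ∈ Ω) : ∃ e : Vec n, e ≠ 0 ∧ ∀ᶠ x in 𝓝 a, lev x ≤ lev a →
      inner ℝ (mapQ g x y₀ z₀ - mapQ g a y₀ z₀) e ≤ 0 := by
  have h0 : (0 : ℝ) ∈ Icc (0 : ℝ) 1 := ⟨le_rfl, zero_le_one⟩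
  obtain ⟨L, hL, ⟨hL1, hL2⟩, -⟩ := hJ.exists_hasStrictFDerivAt_gSegment ha h0
  have hs0 := hJ.gSegment_zero ha
  have haΓ := hJ.mem_zero a ha
  rw [hs0] at hL1 hL2
  -- The normal `e` is the y-component of the initial velocity of the g-segment; stationarity at a
  -- fixes its z-component as ⟨Q(a), e⟩.
  obtain ⟨⟨e, r⟩, hω⟩ : ∃ ω, L (0, 1) = ω := ⟨_, rfl⟩
  rw [hω] at hL1 hL2
  have hr : r = inner ℝ (mapQ g a y₀ z₀) e := by
    rw [hJ.gen.fderiv_zero_fst haΓ] at hL1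
    exact sub_eq_zero.1 ((mul_eq_zero.1 hL1).resolve_left (hJ.gen.gz_neg _ _ _ haΓ).ne)
  refine ⟨e, ?_, ?_⟩
  · rintro rfl
    rw [inner_zero_right] at hr
    subst hr
    refine hJ.gradGap_ne_zero ha hy ?_
    rw [← hL2]
    exact (congrArg _ (map_zero _)).trans (map_zero _)
  filter_upwards [hJ.eventually_gSegment_le hy ha, hJ.isOpen.mem_nhds ha] with x hx hxΩ hlev
  have hxΓ := hJ.mem_zero x hxΩ
  have d1 : HasDerivAt (fun τ : ℝ => (a, τ)) ((0 : Vec n), (1 : ℝ)) 0 :=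
    (hasDerivAt_const 0 a).prodMk (hasDerivAt_id 0)
  have d2 := hL.hasFDerivAt.comp_hasDerivAt (0 : ℝ) d1
  have hg0 : HasFDerivAt g (fderiv ℝ g (x, y₀, z₀)) (x, seg a 0) := by
    rw [hs0]
    exact (hJ.gen.hasStrictFDerivAt hxΓ).hasFDerivAt
  have d3 : HasDerivAt (fun τ => g (x, seg a τ)) _ 0 :=
    hg0.comp_hasDerivAt (0 : ℝ) ((hasDerivAt_const (0 : ℝ) x).prodMk d2)
  rw [hω, hJ.gen.fderiv_zero_fst hxΓ, hr, ← inner_sub_left] at d3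
  by_contra! hcon
  have hneg : inner ℝ (mapQ g a y₀ z₀ - mapQ g x y₀ z₀) e < 0 := by
    rw [← neg_sub, inner_neg_left]
    linarith
  have h1 := eventually_lt_of_hasDerivAt_pos d3
    (mul_pos_of_neg_of_neg (hJ.gen.gz_neg _ _ _ hxΓ) hneg)
  obtain ⟨s, hs1, hs2⟩ := (h1.and (Ioc_mem_nhdsGT (zero_lt_one (α := ℝ)))).exists
  have h2 := (hx hlev s ⟨hs2.1.le, hs2.2⟩).2
  rw [hs0] at hs1
  exact hs1.not_ge h2

end IsJoined

namespace IsJoined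

variable {Ω : Set (Vec n)} {y₀ y₁ : Vec n} {z₀ : ℝ}

local notation "lev" => contactLevel g Γ y₀ z₀ y₁

/-- The contact level is quasiconvex along segments in the coordinates `mapQ · y₀ z₀`. -/
theorem level_le_max (hJ : IsJoined g Γ Ω y₀ z₀ y₁) (hA1s : CondA1Star g Γ)
    (hconv : Convex ℝ ((fun x => mapQ g x y₀ z₀) '' Ω)) {xa xb x : Vec n} (hxa : xa ∈ Ω)
    (hxb : xb ∈ Ω) (hx : x ∈ Ω)
    (hseg : mapQ g x y₀ z₀ ∈ segment ℝ (mapQ g xa y₀ z₀) (mapQ g xb y₀ z₀)) :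
    lev x ≤ max (lev xa) (lev xb) := by
  -- For y₁ = y₀ the gap vanishes and gives no supporting direction, but the contact level is
  -- constantly z₀.
  rcases eq_or_ne y₁ y₀ with hy | hy
  · have h : ∀ x ∈ Ω, lev x = z₀ := fun x hx => by
      rw [hy]
      exact hJ.gen.gStar_eq (hJ.mem_zero x hx)
    rw [h x hx, h xa hxa]
    exact le_max_left _ _
  set Q : Vec n → Vec n := fun x => mapQ g x y₀ z₀ with hQ
  have hinj : InjOn Q Ω := (hA1s y₀ z₀).mono hJ.mem_zero
  set ψ := Function.invFunOn Q Ω with hψ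
  have hψQ : ∀ x ∈ Ω, ψ (Q x) = x := fun x hx => hinj.leftInvOn_invFunOn hx
  have hψmem : ∀ q ∈ Q '' Ω, ψ q ∈ Ω ∧ Q (ψ q) = q := by
    rintro _ ⟨x, hx, rfl⟩
    rw [hψQ x hx]
    exact ⟨hx, rfl⟩
  have hψreg : ∀ q ∈ Q '' Ω, ContinuousAt ψ q ∧ Q '' Ω ∈ 𝓝 q := by
    rintro _ ⟨x, hx, rfl⟩
    obtain ⟨L, hL⟩ := hJ.gen.exists_mapQ_equiv hJ.a2 (hJ.mem_zero x hx)
    have h := hasStrictFDerivAt_leftInvOn hJ.isOpen hx hL hψQ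
    exact ⟨h.1.continuousAt, h.2⟩
  set d := Q xb - Q xa with hd
  set γ : ℝ → Vec n := fun θ => Q xa + θ • d with hγ
  have hγc : Continuous γ := by fun_prop
  have hγmem : ∀ θ ∈ Icc (0 : ℝ) 1, γ θ ∈ Q '' Ω := fun θ hθ => by
    refine hconv.segment_subset (mem_image_of_mem _ hxa) (mem_image_of_mem _ hxb) ?_
    rw [segment_eq_image']
    exact ⟨θ, hθ, rfl⟩
  have hfc : ∀ q ∈ Q '' Ω, ContinuousAt (fun q => lev (ψ q)) q := fun q hq =>
    (hJ.continuousOn_level.continuousAt (hJ.isOpen.mem_nhds (hψmem q hq).1)).comp (hψreg q hq).1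
  set f : ℝ → ℝ := fun θ => lev (ψ (γ θ)) with hf
  have hfcont : ContinuousOn f (Icc 0 1) := fun θ hθ =>
    (ContinuousAt.comp (g := fun q => lev (ψ q)) (hfc _ (hγmem θ hθ))
      hγc.continuousAt).continuousWithinAt
  obtain ⟨θ₀, hθ₀, hmax⟩ := isCompact_Icc.exists_isMaxOn (nonempty_Icc.2 zero_le_one) hfcont
  have hmax' : ∀ θ ∈ Icc (0 : ℝ) 1, f θ ≤ f θ₀ := fun θ hθ => hmax hθ
  have hf0 : f 0 = lev xa := by simp only [hf, hγ, zero_smul, add_zero, hψQ xa hxa]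
  have hf1 : f 1 = lev xb := by
    simp only [hf, hγ, hd, one_smul, add_sub_cancel, hψQ xb hxb]
  obtain ⟨θx, hθx, hfx⟩ : ∃ θ ∈ Icc (0 : ℝ) 1, f θ = lev x := by
    rw [segment_eq_image'] at hseg
    obtain ⟨θ, hθ, h⟩ := hseg
    refine ⟨θ, hθ, ?_⟩
    have : γ θ = Q x := h
    simp only [hf, this, hψQ x hx]
  rw [← hfx, ← hf0, ← hf1]
  refine (hmax' θx hθx).trans ?_
  by_contra! hlt
  obtain ⟨hlt0, hlt1⟩ := max_lt_iff.1 hlt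
  -- The first maximum point along the segment: immediately to its left f is strictly smaller, which
  -- the final perturbation exploits.
  obtain ⟨θs, ⟨hθs, hfs⟩, hleast⟩ : ∃ θs, IsLeast {θ | θ ∈ Icc (0 : ℝ) 1 ∧ f θ₀ ≤ f θ} θs :=
    (isCompact_Icc.of_isClosed_subset
      (hfcont.preimage_isClosed_of_isClosed isClosed_Icc isClosed_Ici)
        fun θ hθ => hθ.1).exists_isLeast ⟨θ₀, hθ₀, le_refl (f θ₀)⟩
  have hs0 : 0 < θs := hθs.1.lt_of_ne' (by rintro rfl; linarith)
  have hs1 : θs < 1 := hθs.2.lt_of_ne (by rintro rfl; linarith)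
  obtain ⟨e, he, hsupp⟩ := hJ.exists_local_support hy (hψmem _ (hγmem θs hθs)).1
  have hψs := (hψmem _ (hγmem θs hθs)).2
  have hsupp' : ∀ᶠ q in 𝓝 (γ θs), lev (ψ q) ≤ f θs → inner ℝ (q - γ θs) e ≤ 0 := by
    obtain ⟨hc, hn⟩ := hψreg _ (hγmem θs hθs)
    filter_upwards [hc.eventually hsupp, hn] with q hq hqm hle
    have := hq hle
    change inner ℝ (Q (ψ q) - Q (ψ (γ θs))) e ≤ 0 at this
    rwa [hψs, (hψmem q hqm).2] at this
  have hdiff : ∀ θ, γ θ - γ θs = (θ - θs) • d := fun θ => by simp only [hγ]; module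
  have hline : ∀ᶠ θ in 𝓝 θs, inner ℝ d e * (θ - θs) ≤ 0 := by
    filter_upwards [hγc.continuousAt.eventually hsupp', Icc_mem_nhds hs0 hs1] with θ h1 h2
    have := h1 ((hmax' θ h2).trans hfs)
    rw [hdiff, real_inner_smul_left] at this
    linarith
  -- The whole segment lies in the sublevel set of its maximum, so near the interior point θs both
  -- directions lie in the supporting half-space; the segment lies in the hyperplane.
  have hde : inner ℝ d e = 0 := by
    have hd1 : HasDerivAt (fun θ => inner ℝ d e * (θ - θs)) (inner ℝ d e) θs := by
      simpa using ((hasDerivAt_id θs).sub_const θs).const_mul (inner ℝ d e)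
    refine IsLocalMax.hasDerivAt_eq_zero (f := fun θ => inner ℝ d e * (θ - θs)) ?_ hd1
    filter_upwards [hline] with θ hθ
    simpa using hθ
  obtain ⟨θ₁, h1, h2⟩ : ∃ θ₁, (∀ᶠ q in 𝓝 (γ θ₁), lev (ψ q) ≤ f θs → inner ℝ (q - γ θs) e ≤ 0) ∧
      θ₁ ∈ Ioo 0 θs :=
    (((hγc.continuousAt.eventually hsupp'.eventually_nhds).filter_mono
      nhdsWithin_le_nhds).and (Ioo_mem_nhdsLT hs0)).exists
  have hθ₁ : θ₁ ∈ Icc (0 : ℝ) 1 := ⟨h2.1.le, h2.2.le.trans hθs.2⟩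
  have hlt₁ : lev (ψ (γ θ₁)) < f θs := by
    by_contra! h
    exact (hleast ⟨hθ₁, hfs.trans h⟩).not_gt h2.2
  have h3 := (hfc _ (hγmem θ₁ hθ₁)).eventually (gt_mem_nhds hlt₁)
  -- From γ θ₁, where lev is strictly below the maximum, a small push along `e` stays in the
  -- sublevel set but leaves the half-space.
  have hpush : Tendsto (fun ρ : ℝ => γ θ₁ + ρ • e) (𝓝[>] 0) (𝓝 (γ θ₁)) :=
    (Continuous.tendsto' (by fun_prop) _ _ (by simp)).mono_left nhdsWithin_le_nhds
  obtain ⟨ρ, ⟨hρ1, hρ2⟩, hρ⟩ := ((hpush.eventually (h1.and h3)).and self_mem_nhdsWithin).exists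
  have h4 := hρ1 hρ2.le
  rw [add_sub_right_comm, hdiff, inner_add_left, real_inner_smul_left, hde, mul_zero, zero_add,
    real_inner_smul_left] at h4
  exact h4.not_gt (mul_pos hρ (real_inner_self_pos.2 he))

end IsJoined

/-- A set that contains every point of `Ω` lying, in the coordinates `mapQ · y₀ z₀`, on a segment
between two of its points is `g`-convex. -/
theorem IsGConvexSet.of_segment {Ω S : Set (Vec n)} {y₀ : Vec n} {z₀ : ℝ}
    (hΩ : IsGConvexSet g Γ Ω y₀ z₀) (hS : S ⊆ Ω)
    (h : ∀ xa ∈ S, ∀ xb ∈ S, ∀ x ∈ Ω,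
      mapQ g x y₀ z₀ ∈ segment ℝ (mapQ g xa y₀ z₀) (mapQ g xb y₀ z₀) → x ∈ S) :
    IsGConvexSet g Γ S y₀ z₀ := by
  refine ⟨fun x hx => hΩ.1 x (hS hx), convex_iff_segment_subset.2 ?_⟩
  rintro _ ⟨xa, hxa, rfl⟩ _ ⟨xb, hxb, rfl⟩ q hq
  obtain ⟨x, hx, rfl⟩ := hΩ.2.segment_subset (mem_image_of_mem _ (hS hxa))
    (mem_image_of_mem _ (hS hxb)) hq
  exact mem_image_of_mem _ (h xa hxa xb hxb x hx hq)

end GenConvex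

end

theorem theorem3p1 (n : ℕ) (Γ : Set (GenConvex.Vec n × GenConvex.Vec n × ℝ))
    (g : GenConvex.Vec n × GenConvex.Vec n × ℝ → ℝ)
    (hg : GenConvex.IsGeneratingFunction g Γ)
    (hA1 : GenConvex.CondA1 g Γ) (hA2 : GenConvex.CondA2 g Γ)
    (hA1s : GenConvex.CondA1Star g Γ) (hA3w : GenConvex.CondA3w g Γ)
    (Ω : Set (GenConvex.Vec n)) (hΩo : IsOpen Ω) (hΩc : IsConnected Ω)
    (u : GenConvex.Vec n → ℝ) (hu : GenConvex.IsGConvexFun g Γ Ω u)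
    (y₀ : GenConvex.Vec n) (z₀ : ℝ)
    (hΩ : GenConvex.IsGConvexSet g Γ Ω y₀ z₀)
    (hseg : ∀ x₁ ∈ Ω, ∀ y ∈ GenConvex.gNormal g Γ Ω u x₁, ∀ x ∈ Ω,
      (x, y, g (x, y₀, z₀)) ∈ GenConvex.dualDomain g Γ ∧
      segment ℝ (GenConvex.gx g x y₀ z₀)
          (GenConvex.gx g x y (GenConvex.gStar g Γ x y (g (x, y₀, z₀)))) ⊆
        GenConvex.jetFiber g Γ x (g (x, y₀, z₀))) :
    GenConvex.IsGConvexSet g Γ (GenConvex.gSection g Ω u y₀ z₀) y₀ z₀ ∧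
      GenConvex.IsGConvexSet g Γ (GenConvex.gClosedSection g Ω u y₀ z₀) y₀ z₀ := by
  -- Each support of u belongs to the g-normal mapping, so the segment hypothesis makes it joined to
  -- (y₀, z₀) over all of Ω.
  have support : ∀ x ∈ Ω, ∃ y₁ z₁, GenConvex.IsJoined g Γ Ω y₀ z₀ y₁ ∧ u x = g (x, y₁, z₁) ∧
      ∀ x' ∈ Ω, (x', y₁, z₁) ∈ Γ ∧ g (x', y₁, z₁) ≤ u x' := by
    intro x hx
    obtain ⟨y₁, z₁, hΓ, hux, hle⟩ := hu.2 x hx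
    have hz : GenConvex.gStar g Γ x y₁ (u x) = z₁ := by
      rw [hux]
      exact hg.gStar_eq (hΓ x hx)
    have hy : y₁ ∈ GenConvex.gNormal g Γ Ω u x := by
      refine ⟨?_, ?_, ?_⟩
      · rw [hux]
        exact GenConvex.mem_dualDomain (hΓ x hx)
      · rw [hz]
        exact hΓ
      · rw [hz]
        exact hle
    exact ⟨y₁, z₁, ⟨hg, hA1, hA2, hA3w, hΩo, hΩ.1, fun x' hx' => (hseg x hx y₁ hy x' hx').1,
      fun x' hx' => (hseg x hx y₁ hy x' hx').2⟩, hux, fun x' hx' => ⟨hΓ x' hx', hle x' hx'⟩⟩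
  refine ⟨hΩ.of_segment (fun x hx => hx.1) ?_, hΩ.of_segment (fun x hx => hx.1) ?_⟩
  · intro xa hxa xb hxb x hx hq
    refine ⟨hx, ?_⟩
    -- The support is taken at the intermediate point, where it equals u; at the end points it lies
    -- below u, so their membership in the section passes to it.
    obtain ⟨y₁, z₁, hJ, hux, hle⟩ := support x hx
    have hlt : ∀ x' ∈ Ω, g (x', y₁, z₁) < g (x', y₀, z₀) ↔
        GenConvex.contactLevel g Γ y₀ z₀ y₁ x' < z₁ := fun x' hx' => by
      rw [← (hJ.level_spec hx').2]
      exact (hg.strictAntiOn x' y₁).lt_iff_gt (hle x' hx').1 (hJ.level_spec hx').1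
    rw [hux, hlt x hx]
    refine (hJ.level_le_max hA1s hΩ.2 hxa.1 hxb.1 hx hq).trans_lt (max_lt ?_ ?_)
    · exact (hlt xa hxa.1).1 ((hle xa hxa.1).2.trans_lt hxa.2)
    · exact (hlt xb hxb.1).1 ((hle xb hxb.1).2.trans_lt hxb.2)
  · intro xa hxa xb hxb x hx hq
    refine ⟨hx, ?_⟩
    obtain ⟨y₁, z₁, hJ, hux, hle⟩ := support x hx
    have hlt : ∀ x' ∈ Ω, g (x', y₁, z₁) ≤ g (x', y₀, z₀) ↔
        GenConvex.contactLevel g Γ y₀ z₀ y₁ x' ≤ z₁ := fun x' hx' => by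
      rw [← (hJ.level_spec hx').2]
      exact (hg.strictAntiOn x' y₁).le_iff_ge (hle x' hx').1 (hJ.level_spec hx').1
    rw [hux, hlt x hx]
    refine (hJ.level_le_max hA1s hΩ.2 hxa.1 hxb.1 hx hq).trans (max_le ?_ ?_)
    · exact (hlt xa hxa.1).1 ((hle xa hxa.1).2.trans hxa.2)
    · exact (hlt xb hxb.1).1 ((hle xb hxb.1).2.trans hxb.2)
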